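/- **Setting.** Let $m_N>0$ with $m_N\to\infty$ and $m_N=o(N)$. Identify $v\in\mathbb{R}^N$ with the step function on $[0,\infty)$ equal to $v_i$ on $[(i-1)/m_N,i/m_N)$, $1\le i\le N$, and $0$ elsewhere, so that its $L^2[0,\infty)$ norm is $\|v\|^2=m_N^{-1}\sum_i v_i^2$. On $\mathbb{R}^N$ let $T_N$ be the left shift, $T_N^*$ the right shift (both filling in $0$), $D_N=m_N(T_N-1)$ and $D_N^*=m_N(T_N^*-1)$. Let $(y^N_{i;j})_{0\le j\le N}$, $i=1,2$, be random sequences with $y^N_{i;0}=0$, all defined on one probability space, let $w_N$ be real random variables, and write $y_i^N$ also for the step function equal to $y^N_{i;j}$ on $[j/m_N,(j+1)/m_N)$. Define on $\mathbb{R}^N$ $$H_{N,w_N}=D_N^*D_N+(D_Ny_1^N)_\times+(D_Ny_2^N)_\times\tfrac12(T_N+T_N^*)+w_Nm_NE_{11},\qquad H_N=T_NH_{N,w_N},$$ where $a_\times$ is entrywise multiplication by $a$ and $(D_Ny_i^N)_j=m_N(y^N_{i;j}-y^N_{i;j-1})$ for $1\le j\le N$. The third term may alternatively be replaced by its symmetric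 version $\tfrac12\big((D_Ny_2^N)_\times T_N+T_N^*(D_Ny_2^N)_\times\big)$; the result holds for both. The operator $H_N$ is $H_{N,w_N}$ with its first row removed, and does not depend on $w_N$. Let $\bar\eta>0$ be a continuous, nondecreasing, unbounded function on $[0,\infty)$, and put $\|v\|_*^2=\|\sqrt{1+\bar\eta}\,v\|^2+\|D_Nv\|^2$ for $v\in\mathbb{R}^N$. Assume that, along a given subsequence of $N$, almost surely $y_i^N\to y_i$ uniformly on compact subsets of $[0,\infty)$ for $i=1,2$, with $y_1,y_2$ continuous. Put $y=y_1+y_2$, $f^{[1]}=f'-yf$, $\mathcal{H}f=-(f^{[1]})'-yf'$, and $$\mathcal{D}_{\max}=\{f\in H^1_{\mathrm{loc}}[0,\infty)\cap L^2:\ f^{[1]}\in H^1_{\mathrm{loc}}[0,\infty),\ \mathcal{H}f\in L^2\},$$ where functions in $H^1_{\mathrm{loc}}$ are represented by their continuous versions. **Lemma.** Almost surely the following holds. Let $f_N\in\mathbb{R}^N$ be such that $\|H_Nf_N\|$ and $\|f_N\|_*$ are bounded uniformly in $N$ along the given subsequence. Then there are $f\in\mathcal{D}_{\max}$ and a further subsequence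 along which * $f_N\to f$ uniformly on compact subsets of $[0,\infty)$ and in $L^2[0,\infty)$; * $D_Nf_N\to f'$ uniformly on compact subsets of $[0,\infty)$ and weakly in $L^2[0,\infty)$ (in particular $f'\in L^2$); * $H_Nf_N\to\mathcal{H}f$ weakly in $L^2[0,\infty)$. -/

import Mathlib

open MeasureTheory Set Filter Topology Asymptotics

noncomputable section

namespace SpikedTridiagonal

/-! ### Vectors of length `n`, mesh `1 / m`, and their images in `L²[0,∞)`

Coordinates are numbered from `0`, so coordinate `i` is the basis vector `e_(i+1)`. -/

/-- The embedding into functions on `[0,∞)`: the vector `v` becomes the step function with value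
`v i` on `[i/m, (i+1)/m)`, and `0` elsewhere. -/
def stepFn (m : ℝ) {n : ℕ} (v : Fin n → ℝ) : ℝ → ℝ := fun x =>
  ∑ i : Fin n, (Ico ((i : ℝ) / m) (((i : ℝ) + 1) / m)).indicator (fun _ => v i) x

/-- The norm `‖v‖² = m⁻¹ ∑ v_i²` (the `L²` norm of the step function). -/
def vecNorm (m : ℝ) {n : ℕ} (v : Fin n → ℝ) : ℝ := Real.sqrt (m⁻¹ * ∑ i, v i ^ 2)

/-- The left shift `T`. -/
def shiftL {n : ℕ} (v : Fin n → ℝ) : Fin n → ℝ := fun i =>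
  if h : (i : ℕ) + 1 < n then v ⟨i + 1, h⟩ else 0

/-- The right shift, that is the adjoint `T*` followed by the projection onto `ℝⁿ`. -/
def shiftR {n : ℕ} (v : Fin n → ℝ) : Fin n → ℝ := fun i =>
  if 0 < (i : ℕ) then v ⟨i - 1, lt_of_le_of_lt (Nat.sub_le _ _) i.2⟩ else 0

/-- The difference quotient `D = m (T - 1)`. -/
def diffQ (m : ℝ) {n : ℕ} (v : Fin n → ℝ) : Fin n → ℝ := fun i => m * (shiftL v i - v i)

/-- Its adjoint `D* = m (T* - 1)`. -/
def diffQAdj (m : ℝ) {n : ℕ} (v : Fin n → ℝ) : Fin n → ℝ := fun i => m * (shiftR v i - v i)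

/-- The first `N` entries `m (y_(j+1) - y_j)`, `0 ≤ j < N`, of the difference quotient of a
sequence `y_0, …, y_N`. -/
def pathDiff (m : ℝ) {N : ℕ} (y : Fin (N + 1) → ℝ) : Fin N → ℝ := fun j =>
  m * (y j.succ - y j.castSucc)

/-- The two possible orders of factors in the off-diagonal part of the potential. -/
inductive FactorOrder
  | multiplyLast
  | symmetric

/-- The off-diagonal part of the potential, with `a = D y₂`: either `a_× ½ (T + T*)`, or the
symmetric matrix `½ (a_× T + T* a_×)`. -/
def offDiagPotential : FactorOrder → {n : ℕ} → (Fin n → ℝ) → (Fin n → ℝ) → Fin n → ℝ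
  | .multiplyLast, _, a, v => fun i => a i * ((1 / 2) * (shiftL v i + shiftR v i))
  | .symmetric, _, a, v => fun i => (1 / 2) * (a i * shiftL v i + shiftR (fun j => a j * v j) i)

/-- The spiked tridiagonal operator
`H_(N,w) = D*D + (D y₁)_× + (off-diagonal part from D y₂) + w m E₁₁` on `ℝᴺ`. -/
def spikedH (o : FactorOrder) (m : ℝ) {N : ℕ} (y₁ y₂ : Fin (N + 1) → ℝ) (w : ℝ)
    (v : Fin N → ℝ) : Fin N → ℝ := fun i =>
  diffQAdj m (diffQ m v) i + pathDiff m y₁ i * v i + offDiagPotential o (pathDiff m y₂) v i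
    + w * m * (if (i : ℕ) = 0 then v i else 0)

/-- `H_N = T H_(N,w)`: the operator `H_(N,w)` with its first row removed. -/
def reducedH (o : FactorOrder) (m : ℝ) {N : ℕ} (y₁ y₂ : Fin (N + 1) → ℝ) (w : ℝ)
    (v : Fin N → ℝ) : Fin N → ℝ :=
  shiftL (spikedH o m y₁ y₂ w v)

/-- `H_N` does not depend on the spike `w`. -/
theorem reducedH_spike_irrelevant (o : FactorOrder) (m : ℝ) {N : ℕ} (y₁ y₂ : Fin (N + 1) → ℝ)
    (w w' : ℝ) (v : Fin N → ℝ) : reducedH o m y₁ y₂ w v = reducedH o m y₁ y₂ w' v := by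
  funext i
  simp [reducedH, shiftL, spikedH]

/-- Lebesgue measure on `[0,∞)`. -/
def halfLine : Measure ℝ := volume.restrict (Ici 0)

/-- The weighted norm `‖v‖_*² = ‖√(1 + η) v‖² + ‖D v‖²`, the first term being an `L²[0,∞)` norm of
the step function. -/
def starNorm (η : ℝ → ℝ) (m : ℝ) {n : ℕ} (v : Fin n → ℝ) : ℝ :=
  Real.sqrt ((∫ x, (Real.sqrt (1 + η x) * stepFn m v x) ^ 2 ∂halfLine)
    + vecNorm m (diffQ m v) ^ 2)

/-! ### Modes of convergence of functions on `[0,∞)` -/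

/-- Uniform convergence on the compact subsets of `[0,∞)`. -/
def CompactUniform (u : ℕ → ℝ → ℝ) (g : ℝ → ℝ) : Prop :=
  ∀ R : ℝ, TendstoUniformlyOn u g atTop (Icc 0 R)

/-- Convergence in `L²[0,∞)`. -/
def StrongL2 (u : ℕ → ℝ → ℝ) (g : ℝ → ℝ) : Prop :=
  MemLp g 2 halfLine ∧ Tendsto (fun k => eLpNorm (u k - g) 2 halfLine) atTop (𝓝 0)

/-- Weak convergence in `L²[0,∞)`. -/
def WeakL2 (u : ℕ → ℝ → ℝ) (g : ℝ → ℝ) : Prop :=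
  MemLp g 2 halfLine ∧ ∀ h : ℝ → ℝ, MemLp h 2 halfLine →
    Tendsto (fun k => ∫ x, u k x * h x ∂halfLine) atTop (𝓝 (∫ x, g x * h x ∂halfLine))

/-! ### The continuum operator `𝓗 = -d²/dx² + y'` -/

/-- The derivative on `[0,∞)`, one-sided at `0`. -/
def halfDeriv (f : ℝ → ℝ) : ℝ → ℝ := derivWithin f (Ici 0)

/-- `H¹_loc` of `[0,∞)`, in terms of continuous representatives: absolutely continuous on every
`[0,R]`, with derivative in `L²[0,R]`. -/
def InH1Loc (f : ℝ → ℝ) : Prop :=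
  ∀ R : ℝ, 0 < R → AbsolutelyContinuousOnInterval f 0 R ∧
    MemLp (halfDeriv f) 2 (volume.restrict (Icc 0 R))

/-- The first quasi-derivative `f^[1] = f' - y f`. -/
def quasiDeriv (y f : ℝ → ℝ) : ℝ → ℝ := fun x => halfDeriv f x - y x * f x

/-- `𝓗 f = -(f^[1])' - y f'`. -/
def contH (y f : ℝ → ℝ) : ℝ → ℝ := fun x => -halfDeriv (quasiDeriv y f) x - y x * halfDeriv f x

/-- The maximal domain `𝓓_max` of `𝓗`. -/
def maxDomain (y : ℝ → ℝ) : Set (ℝ → ℝ) :=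
  {f | InH1Loc f ∧ MemLp f 2 halfLine ∧ InH1Loc (quasiDeriv y f) ∧ MemLp (contH y f) 2 halfLine}

end SpikedTridiagonal

end

namespace SpikedTridiagonal

/-! The noise `D y` has no limit as a function, so the equation for `H_N f_N` is used only after
summation by parts, where `y` itself appears and converges locally uniformly.

Weak compactness in `L²` gives, along a subsequence, weak limits `G` of `D f_N` and `H` of `H_N
f_N`, and a limit `c` of the first entries, which are bounded by a discrete trace estimate. Since
`f_N` is its first entry plus a discrete integral of `D f_N`, the bound on `D f_N` yields a common
Hölder-1/2 modulus, and `f_N → f = c + ∫ G` locally uniformly.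

Summing the rows of `H_N f_N` (`diffQ_sum`) expresses `D f_N - D f_N(0)` by a discrete integral of
`H_N f_N`, a boundary term tending to `y f`, and a discrete integral of `D f_N` against a
coefficient tending to `y`. All of these converge locally uniformly, because a locally uniformly
convergent factor times a weakly convergent one has convergent integrals. The constant `D f_N(0)`
then converges by comparing integrals over `[0,1]`. Hence `D f_N → y f + d + ∫ (-H - y G)` locally
uniformly (`compactUniform_diffQ`).

The two limits of `D f_N` have the same primitive, so `f'` is the continuous one, `f^[1] = d + ∫ (-H
- y f')`, and `H = 𝓗 f` almost everywhere (`limit_regularity`). Strong `L²` convergence of `f_N`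
follows from local uniform convergence and the tightness provided by the unbounded weight
(`strongL2_of_weight`). -/

/-- The extension of a vector by zeros. -/
def zeroExt {n : ℕ} (v : Fin n → ℝ) : ℕ → ℝ := fun i => if h : i < n then v ⟨i, h⟩ else 0

/-- The function with value `a i` on the mesh interval `[i/m, (i+1)/m)`. -/
noncomputable def gridFn (m : ℝ) (a : ℕ → ℝ) : ℝ → ℝ := fun x => a ⌊m * x⌋₊

/-! ### Step functions on the mesh and their integrals -/

theorem mem_mesh_iff {m : ℝ} (hm : 0 < m) {x : ℝ} (hx : 0 ≤ x) (i : ℕ) :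
    x ∈ Ico ((i : ℝ) / m) (((i : ℝ) + 1) / m) ↔ ⌊m * x⌋₊ = i := by
  rw [Nat.floor_eq_iff (by positivity), mem_Ico, div_le_iff₀ hm, lt_div_iff₀ hm, mul_comm x m]

/-- The restriction to `0 ≤ x` matters: `Nat.floor` is `0` on negative numbers, so `gridFn` takes
its first value there, whereas `stepFn` vanishes. -/
theorem stepFn_eq_gridFn {m : ℝ} (hm : 0 < m) {n : ℕ} (v : Fin n → ℝ) {x : ℝ} (hx : 0 ≤ x) :
    stepFn m v x = gridFn m (zeroExt v) x := by
  unfold stepFn gridFn zeroExt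
  simp only [indicator_apply, mem_mesh_iff hm hx]
  split_ifs with h
  · rw [Finset.sum_eq_single ⟨⌊m * x⌋₊, h⟩]
    · simp
    · intro b _ hb
      rw [if_neg]
      rintro h'
      exact hb (Fin.ext h'.symm)
    · simp
  · refine Finset.sum_eq_zero fun i _ => if_neg ?_
    have := i.2
    omega

theorem memLp_stepFn (m : ℝ) {n : ℕ} (v : Fin n → ℝ) : MemLp (stepFn m v) 2 halfLine := by
  refine memLp_finsetSum _ fun i _ => ?_
  refine memLp_indicator_const 2 measurableSet_Ico _ (Or.inr ?_)
  refine ne_top_of_le_ne_top ?_ (Measure.restrict_apply_le _ _)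
  simp

theorem integral_stepFn {m : ℝ} (hm : 0 < m) {n : ℕ} (v : Fin n → ℝ) :
    ∫ x, stepFn m v x ∂halfLine = m⁻¹ * ∑ i, v i := by
  unfold stepFn
  have hsub (i : Fin n) : Ico ((i : ℝ) / m) (((i : ℝ) + 1) / m) ⊆ Ici 0 := fun x hx =>
    (by positivity : (0 : ℝ) ≤ (i : ℝ) / m).trans hx.1
  have hmeas (i : Fin n) : halfLine.real (Ico ((i : ℝ) / m) (((i : ℝ) + 1) / m)) = m⁻¹ := by
    rw [measureReal_def, halfLine, Measure.restrict_eq_self _ (hsub i), Real.volume_Ico,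
      ← sub_div, add_sub_cancel_left, one_div, ENNReal.toReal_ofReal (by positivity)]
  rw [integral_finsetSum]
  · simp_rw [integral_indicator_const _ measurableSet_Ico, hmeas, smul_eq_mul, Finset.mul_sum]
  · intro i _
    refine (integrable_indicator_iff measurableSet_Ico).2 (integrableOn_const ?_)
    refine ne_top_of_le_ne_top ?_ (Measure.restrict_apply_le _ _)
    simp

theorem ae_halfLine_nonneg : ∀ᵐ x ∂halfLine, (0 : ℝ) ≤ x :=
  ae_restrict_mem measurableSet_Ici

theorem integral_stepFn_sq {m : ℝ} (hm : 0 < m) {n : ℕ} (v : Fin n → ℝ) :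
    ∫ x, stepFn m v x ^ 2 ∂halfLine = vecNorm m v ^ 2 := by
  rw [vecNorm, Real.sq_sqrt (by positivity), ← integral_stepFn hm (fun i => v i ^ 2)]
  refine integral_congr_ae ?_
  filter_upwards [ae_halfLine_nonneg] with x hx
  simp only [stepFn_eq_gridFn hm _ hx, gridFn, zeroExt]
  split_ifs <;> simp

theorem measurable_gridFn (m : ℝ) (a : ℕ → ℝ) : Measurable (gridFn m a) :=
  (measurable_from_top (f := a)).comp (Nat.measurable_floor.comp (measurable_const_mul m))

theorem gridFn_zero (m : ℝ) (a : ℕ → ℝ) : gridFn m a 0 = a 0 := by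
  simp [gridFn]

theorem floor_div_nonneg {m : ℝ} (hm : 0 < m) (x : ℝ) : 0 ≤ (⌊m * x⌋₊ : ℝ) / m := by positivity

theorem floor_div_le {m : ℝ} (hm : 0 < m) {x : ℝ} (hx : 0 ≤ x) : (⌊m * x⌋₊ : ℝ) / m ≤ x := by
  rw [div_le_iff₀ hm, mul_comm x m]
  exact Nat.floor_le (by positivity)

theorem sub_floor_div_le {m : ℝ} (hm : 0 < m) (x : ℝ) : x - (⌊m * x⌋₊ : ℝ) / m ≤ m⁻¹ := by
  rw [sub_le_iff_le_add, ← one_div, ← add_div, le_div_iff₀ hm, mul_comm x m, add_comm]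
  exact (Nat.lt_floor_add_one _).le

theorem gridFn_succ {m : ℝ} (hm : 0 < m) (a : ℕ → ℝ) {x : ℝ} (hx : 0 ≤ x) :
    gridFn m (fun i => a (i + 1)) x = gridFn m a (x + m⁻¹) := by
  unfold gridFn
  rw [mul_add, mul_inv_cancel₀ hm.ne', Nat.floor_add_one (by positivity)]

theorem integral_gridFn {m : ℝ} (hm : 0 < m) (a : ℕ → ℝ) (j : ℕ) :
    IntervalIntegrable (gridFn m a) volume 0 ((j : ℝ) / m) ∧
      ∫ x in (0 : ℝ)..(j : ℝ) / m, gridFn m a x = m⁻¹ * ∑ i ∈ Finset.range j, a i := by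
  induction j with
  | zero => simp
  | succ j ih =>
    have hle : (j : ℝ) / m ≤ ((j + 1 : ℕ) : ℝ) / m := by gcongr; simp
    -- The half-open interval `uIoc` contains the right endpoint, where `gridFn` already has its
    -- next value; that point is null.
    have hae : ∀ᵐ x, x ∈ uIoc ((j : ℝ) / m) (((j + 1 : ℕ) : ℝ) / m) → a j = gridFn m a x := by
      have hne : ∀ᵐ x : ℝ, x ≠ ((j + 1 : ℕ) : ℝ) / m := by simp [ae_iff, measure_singleton]
      filter_upwards [hne] with x hx hx'
      rw [uIoc_of_le hle] at hx'
      have h0 : 0 ≤ x := (by positivity : (0 : ℝ) ≤ (j : ℝ) / m).trans hx'.1.le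
      have := (mem_mesh_iff hm h0 j).1 ⟨hx'.1.le, by
        have := lt_of_le_of_ne hx'.2 hx
        push_cast at this
        exact this⟩
      rw [gridFn, this]
    have hint : IntervalIntegrable (gridFn m a) volume ((j : ℝ) / m) (((j + 1 : ℕ) : ℝ) / m) := by
      refine (intervalIntegrable_const (c := a j)).congr_ae ?_
      exact (ae_restrict_iff' measurableSet_uIoc).2 hae
    refine ⟨ih.1.trans hint, ?_⟩
    rw [← intervalIntegral.integral_add_adjacent_intervals ih.1 hint, ih.2,
      ← intervalIntegral.integral_congr_ae hae, intervalIntegral.integral_const,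
      Finset.sum_range_succ, smul_eq_mul]
    push_cast
    field_simp
    ring

/-! ### Entries of the operators and summation by parts -/

theorem zeroExt_of_lt {n : ℕ} (v : Fin n → ℝ) {i : ℕ} (h : i < n) : zeroExt v i = v ⟨i, h⟩ :=
  dif_pos h

theorem shiftL_apply {n : ℕ} (v : Fin n → ℝ) (i : Fin n) : shiftL v i = zeroExt v (i + 1) := rfl

theorem zeroExt_diffQ (m : ℝ) {n : ℕ} (v : Fin n → ℝ) (i : ℕ) :
    zeroExt (diffQ m v) i = m * (zeroExt v (i + 1) - zeroExt v i) := by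
  by_cases h : i < n
  · rw [zeroExt_of_lt _ h, diffQ, shiftL_apply, zeroExt_of_lt v h]
  · simp [zeroExt, h, show ¬ i + 1 < n by omega]

theorem shiftR_succ {n : ℕ} (v : Fin n → ℝ) {i : ℕ} (h : i + 1 < n) :
    shiftR v ⟨i + 1, h⟩ = zeroExt v i := by
  simp [shiftR, zeroExt, show i < n by omega]

theorem pathDiff_apply (m : ℝ) {n : ℕ} (y : Fin (n + 1) → ℝ) {i : ℕ} (h : i < n) :
    pathDiff m y ⟨i, h⟩ = m * (zeroExt y (i + 1) - zeroExt y i) := by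
  rw [pathDiff, zeroExt_of_lt y (by omega : i + 1 < n + 1), zeroExt_of_lt y (by omega : i < n + 1)]
  rfl

/-- The boundary term of the summation by parts of the potential. -/
noncomputable def boundaryTerm : FactorOrder → (ℕ → ℝ) → (ℕ → ℝ) → (ℕ → ℝ) → ℕ → ℝ
  | .multiplyLast, a, b, v => fun j => a (j + 1) * v j
      + (1 / 2) * (b j * v j + (b (j + 1) - b j) * v (j + 1) + b (j + 1) * v j)
  | .symmetric, a, b, v => fun j => a (j + 1) * v j
      + (1 / 2) * (b j * v j + (b (j + 1) - b j) * v (j + 1) + b j * v j)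

/-- The coefficient of `D v` in the summation by parts of the potential. -/
noncomputable def gradientCoeff : FactorOrder → (ℕ → ℝ) → (ℕ → ℝ) → ℕ → ℝ
  | .multiplyLast, a, b => fun i => a (i + 1) + (1 / 2) * (b i + b (i + 2))
  | .symmetric, a, b => fun i => a (i + 1) + (1 / 2) * (b i + b (i + 1))

/-- Entry `i` of the reduced operator is row `i + 1` of the full one, so the spike never enters. The
discrete Leibniz rule turns each increment of `y` times `v` into an increment of `boundaryTerm`
minus `gradientCoeff` times `D v`. The summand `(b (j+1) - b j) * v (j+1)` of `boundaryTerm` absorbs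
the entry of `v` reached by the left shift, so that `D v` is needed at index `i` only. -/
theorem diffQ_step (o : FactorOrder) {m : ℝ} (hm : 0 < m) {n : ℕ} (y₁ y₂ : Fin (n + 1) → ℝ) (w : ℝ)
    (v : Fin n → ℝ) {i : ℕ} (hi : i + 2 < n) :
    zeroExt (diffQ m v) (i + 1) = zeroExt (diffQ m v) i
      - m⁻¹ * zeroExt (reducedH o m y₁ y₂ w v) i
      + (boundaryTerm o (zeroExt y₁) (zeroExt y₂) (zeroExt v) (i + 1)
        - boundaryTerm o (zeroExt y₁) (zeroExt y₂) (zeroExt v) i)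
      - m⁻¹ * (gradientCoeff o (zeroExt y₁) (zeroExt y₂) i * zeroExt (diffQ m v) i) := by
  have h1 : i + 1 < n := by omega
  have h0 : i < n := by omega
  have e : m⁻¹ * zeroExt (reducedH o m y₁ y₂ w v) i =
      (zeroExt (diffQ m v) i - zeroExt (diffQ m v) (i + 1))
      + (zeroExt y₁ (i + 2) - zeroExt y₁ (i + 1)) * zeroExt v (i + 1)
      + m⁻¹ * offDiagPotential o (pathDiff m y₂) v ⟨i + 1, h1⟩ := by
    rw [zeroExt_of_lt _ h0, reducedH, shiftL_apply]
    simp only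
    rw [zeroExt_of_lt _ h1, spikedH, diffQAdj, shiftR_succ, ← zeroExt_of_lt (diffQ m v) h1,
      ← zeroExt_of_lt v h1, pathDiff_apply]
    simp only [Nat.add_eq_zero_iff, one_ne_zero, and_false, if_false, mul_zero, add_zero]
    field_simp
  have e2 : m⁻¹ * offDiagPotential o (pathDiff m y₂) v ⟨i + 1, h1⟩ =
      match o with
      | .multiplyLast => (zeroExt y₂ (i + 2) - zeroExt y₂ (i + 1)) *
          ((1 / 2) * (zeroExt v (i + 2) + zeroExt v i))
      | .symmetric => (1 / 2) * ((zeroExt y₂ (i + 2) - zeroExt y₂ (i + 1)) * zeroExt v (i + 2)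
          + (zeroExt y₂ (i + 1) - zeroExt y₂ i) * zeroExt v i) := by
    cases o
    · simp only [offDiagPotential]
      rw [shiftL_apply, shiftR_succ, pathDiff_apply]
      field_simp
    · simp only [offDiagPotential]
      rw [shiftL_apply, shiftR_succ, pathDiff_apply, zeroExt_of_lt _ h0, zeroExt_of_lt _ h0,
        pathDiff_apply]
      field_simp
  rw [e, e2]
  simp only [zeroExt_diffQ]
  cases o
  · simp only [boundaryTerm, gradientCoeff]
    field_simp
    ring
  · simp only [boundaryTerm, gradientCoeff]
    field_simp
    ring

theorem diffQ_sum (o : FactorOrder) {m : ℝ} (hm : 0 < m) {n : ℕ} (y₁ y₂ : Fin (n + 1) → ℝ) (w : ℝ)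
    (v : Fin n → ℝ) {j : ℕ} (hj : j + 1 < n) :
    zeroExt (diffQ m v) j = zeroExt (diffQ m v) 0
      - m⁻¹ * ∑ i ∈ Finset.range j, zeroExt (reducedH o m y₁ y₂ w v) i
      + (boundaryTerm o (zeroExt y₁) (zeroExt y₂) (zeroExt v) j
        - boundaryTerm o (zeroExt y₁) (zeroExt y₂) (zeroExt v) 0)
      - m⁻¹ * ∑ i ∈ Finset.range j,
          gradientCoeff o (zeroExt y₁) (zeroExt y₂) i * zeroExt (diffQ m v) i := by
  induction j with
  | zero => simp
  | succ j ih =>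
    rw [diffQ_step o hm y₁ y₂ w v hj, Finset.sum_range_succ, Finset.sum_range_succ]
    linear_combination ih (by omega)

theorem zeroExt_eq_sum_diffQ {m : ℝ} (hm : 0 < m) {n : ℕ} (v : Fin n → ℝ) (j : ℕ) :
    zeroExt v j = zeroExt v 0 + m⁻¹ * ∑ i ∈ Finset.range j, zeroExt (diffQ m v) i := by
  simp only [zeroExt_diffQ, ← Finset.mul_sum, Finset.sum_range_sub]
  field_simp
  ring

/-! ### Square integrable functions on the half line -/

theorem restrict_Icc_le_halfLine {s : ℝ} (hs : 0 ≤ s) (t : ℝ) :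
    volume.restrict (Icc s t) ≤ halfLine :=
  Measure.restrict_mono (fun _ hx => hs.trans hx.1) le_rfl

theorem restrict_Ioc_le_halfLine {s : ℝ} (hs : 0 ≤ s) (t : ℝ) :
    volume.restrict (Ioc s t) ≤ halfLine :=
  Measure.restrict_mono (fun _ hx => hs.trans hx.1.le) le_rfl

theorem intervalIntegrable_of_memLp {f : ℝ → ℝ} (hf : MemLp f 2 halfLine) {s t : ℝ} (hs : 0 ≤ s)
    (ht : 0 ≤ t) : IntervalIntegrable f volume s t := by
  have key {a b : ℝ} (ha : 0 ≤ a) (hab : a ≤ b) : IntervalIntegrable f volume a b :=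
    (intervalIntegrable_iff_integrableOn_Ioc_of_le hab).2
      ((hf.mono_measure (restrict_Ioc_le_halfLine ha b)).integrable (by norm_num))
  rcases le_total s t with h | h
  · exact key hs h
  · exact (key ht h).symm

/-- Cauchy–Schwarz on `[s,t]`, in the form of the nonnegativity of the variance of `|f|` about its
mean. -/
theorem integral_abs_le_of_memLp {f : ℝ → ℝ} (hf : MemLp f 2 halfLine) {C : ℝ} (hC : 0 ≤ C)
    (hfC : ∫ x, f x ^ 2 ∂halfLine ≤ C ^ 2) {s t : ℝ} (hs : 0 ≤ s) (hst : s ≤ t) :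
    ∫ x in s..t, |f x| ≤ C * √(t - s) := by
  rcases hst.eq_or_lt with rfl | hlt
  · simp
  have hf2 : MemLp f 2 (volume.restrict (Ioc s t)) :=
    hf.mono_measure (restrict_Ioc_le_halfLine hs t)
  have hsq : ∫ x in Ioc s t, f x ^ 2 ≤ C ^ 2 :=
    (integral_mono_measure (restrict_Ioc_le_halfLine hs t)
      (Eventually.of_forall fun x => sq_nonneg (f x)) hf.integrable_sq).trans hfC
  have hint : Integrable (fun x => |f x|) (volume.restrict (Ioc s t)) :=
    (hf2.integrable (by norm_num)).abs
  rw [intervalIntegral.integral_of_le hst]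
  set I := ∫ x in Ioc s t, |f x| with hI
  have hL : 0 < t - s := sub_pos.2 hlt
  have hvar : 0 ≤ ∫ x in Ioc s t, (|f x| - I / (t - s)) ^ 2 :=
    integral_nonneg fun x => sq_nonneg _
  have hexp : ∫ x in Ioc s t, (|f x| - I / (t - s)) ^ 2
      = (∫ x in Ioc s t, f x ^ 2) - I ^ 2 / (t - s) := by
    have e : ∀ x, (|f x| - I / (t - s)) ^ 2
        = f x ^ 2 - 2 * (I / (t - s)) * |f x| + (I / (t - s)) ^ 2 := fun x => by
      rw [sub_sq, sq_abs]; ring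
    simp_rw [e]
    rw [integral_add, integral_sub, integral_const_mul, integral_const, ← hI]
    · simp [measureReal_def, hL.le]
      field_simp
      ring
    · exact hf2.integrable_sq
    · exact hint.const_mul _
    · exact hf2.integrable_sq.sub (hint.const_mul _)
    · exact integrable_const _
  have h2 : I ^ 2 ≤ C ^ 2 * (t - s) := by
    rw [hexp, sub_nonneg, div_le_iff₀ hL] at hvar
    nlinarith
  calc I ≤ √(C ^ 2 * (t - s)) := Real.le_sqrt_of_sq_le h2
    _ = C * √(t - s) := by rw [Real.sqrt_mul (sq_nonneg C), Real.sqrt_sq hC]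

theorem intervalIntegrable_mul_of_memLp {f Z : ℝ → ℝ} (hf : MemLp f 2 halfLine)
    (hZ : Measurable Z) {R K : ℝ} (hK : ∀ x ∈ Icc 0 R, |Z x| ≤ K) {s t : ℝ}
    (hs : s ∈ Icc 0 R) (ht : t ∈ Icc 0 R) :
    IntervalIntegrable (fun x => Z x * f x) volume s t := by
  have hfi := intervalIntegrable_of_memLp hf hs.1 ht.1
  rw [intervalIntegrable_iff] at hfi ⊢
  refine hfi.bdd_mul hZ.aestronglyMeasurable (c := K) ?_
  refine (ae_restrict_iff' measurableSet_uIoc).2 (Eventually.of_forall fun x hx => ?_)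
  exact hK x (uIcc_subset_Icc hs ht (uIoc_subset_uIcc hx))

/-- This is the source of all equicontinuity: primitives of `L²`-bounded functions with bounded
coefficients share a Hölder-1/2 modulus. -/
theorem abs_integral_mul_sub_le {f Z : ℝ → ℝ} (hf : MemLp f 2 halfLine) {C : ℝ} (hC : 0 ≤ C)
    (hfC : ∫ x, f x ^ 2 ∂halfLine ≤ C ^ 2) (hZ : Measurable Z) {R K : ℝ}
    (hK : ∀ x ∈ Icc 0 R, |Z x| ≤ K) {s t : ℝ} (hs : s ∈ Icc 0 R) (ht : t ∈ Icc 0 R) :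
    |(∫ x in (0 : ℝ)..s, Z x * f x) - ∫ x in (0 : ℝ)..t, Z x * f x| ≤ K * C * √|s - t| := by
  wlog hst : s ≤ t generalizing s t
  · rw [abs_sub_comm, abs_sub_comm s]
    exact this ht hs (le_of_not_ge hst)
  have h0 : (0 : ℝ) ∈ Icc 0 R := ⟨le_rfl, hs.1.trans hs.2⟩
  have hi {a b : ℝ} (ha : a ∈ Icc 0 R) (hb : b ∈ Icc 0 R) :=
    intervalIntegrable_mul_of_memLp hf hZ hK ha hb
  rw [abs_sub_comm, intervalIntegral.integral_interval_sub_left (hi h0 ht) (hi h0 hs),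
    abs_sub_comm s, abs_of_nonneg (sub_nonneg.2 hst)]
  calc |∫ x in s..t, Z x * f x| ≤ ∫ x in s..t, |Z x * f x| :=
        intervalIntegral.abs_integral_le_integral_abs hst
    _ ≤ ∫ x in s..t, K * |f x| := by
        refine intervalIntegral.integral_mono_on hst (hi hs ht).abs
          ((intervalIntegrable_of_memLp hf hs.1 ht.1).abs.const_mul K) fun x hx => ?_
        rw [abs_mul]
        gcongr
        exact hK x ⟨hs.1.trans hx.1, hx.2.trans ht.2⟩
    _ = K * ∫ x in s..t, |f x| := intervalIntegral.integral_const_mul _ _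
    _ ≤ K * (C * √(t - s)) := by
        have : 0 ≤ K := (abs_nonneg _).trans (hK 0 h0)
        gcongr
        exact integral_abs_le_of_memLp hf hC hfC hs.1 hst
    _ = K * C * √(t - s) := by ring

/-! ### Uniform convergence -/

theorem tendsto_mul_sqrt_zero (C : ℝ) {u : ℕ → ℝ} (hu : Tendsto u atTop (𝓝 0)) :
    Tendsto (fun k => C * √(u k)) atTop (𝓝 0) := by
  have := (hu.sqrt).const_mul C
  simpa using this

/-- The easy half of Arzelà–Ascoli: the limit inherits the common modulus, and pointwise convergence
on a finite net then controls every point. -/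
theorem tendstoUniformlyOn_of_holder {Φ : ℕ → ℝ → ℝ} {Ψ : ℝ → ℝ} {C R : ℝ}
    (hH : ∀ᶠ k in atTop, ∀ s ∈ Icc 0 R, ∀ t ∈ Icc 0 R, |Φ k s - Φ k t| ≤ C * √|s - t|)
    (hp : ∀ x ∈ Icc 0 R, Tendsto (fun k => Φ k x) atTop (𝓝 (Ψ x))) :
    TendstoUniformlyOn Φ Ψ atTop (Icc 0 R) := by
  have hΨ : ∀ s ∈ Icc 0 R, ∀ t ∈ Icc 0 R, |Ψ s - Ψ t| ≤ C * √|s - t| := fun s hs t ht =>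
    le_of_tendsto ((hp s hs).sub (hp t ht)).abs (hH.mono fun k hk => hk s hs t ht)
  rw [Metric.tendstoUniformlyOn_iff]
  intro ε hε
  obtain ⟨δ, hδ, hδC⟩ : ∃ δ > 0, ∀ r, 0 ≤ r → r < δ → C * √r < ε / 3 := by
    have hc : ContinuousAt (fun r => C * √r) 0 := by fun_prop
    obtain ⟨δ, hδ, h⟩ := Metric.continuousAt_iff.1 hc (ε / 3) (by positivity)
    refine ⟨δ, hδ, fun r h0 hr => ?_⟩
    have := h (x := r) (by simpa [abs_of_nonneg h0] using hr)
    rw [Real.dist_eq, Real.sqrt_zero, mul_zero, sub_zero] at this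
    exact (le_abs_self _).trans_lt this
  obtain ⟨T, hTs, hTf, hT⟩ := (isCompact_Icc (a := (0 : ℝ)) (b := R)).finite_cover_balls hδ
  have hev : ∀ᶠ k in atTop, ∀ t ∈ T, |Φ k t - Ψ t| < ε / 3 := by
    refine (hTf.eventually_all).2 fun t ht => ?_
    have := Metric.tendsto_nhds.1 (hp t (hTs ht)) (ε / 3) (by positivity)
    simpa [Real.dist_eq] using this
  filter_upwards [hev, hH] with k hk hHk x hx
  obtain ⟨t, ht, hxt⟩ := mem_iUnion₂.1 (hT hx)
  rw [Metric.mem_ball, Real.dist_eq] at hxt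
  have h1 := hΨ x hx t (hTs ht)
  have h2 := hHk x hx t (hTs ht)
  have h3 := hk t ht
  have h4 := hδC _ (abs_nonneg _) hxt
  rw [Real.dist_eq]
  rw [abs_le] at h1 h2
  rw [abs_lt] at h3 ⊢
  constructor <;> linarith

/-- Discrete sums are primitives evaluated at the mesh point below `x`; this lies within `1 / M k`
of `x`, and the modulus absorbs the displacement. -/
theorem tendstoUniformlyOn_floor_of_holder {Φ : ℕ → ℝ → ℝ} {Ψ : ℝ → ℝ} {C R : ℝ} {M : ℕ → ℝ}
    (hC : 0 ≤ C) (hM : ∀ k, 0 < M k) (hM' : Tendsto M atTop atTop)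
    (hH : ∀ᶠ k in atTop, ∀ s ∈ Icc 0 R, ∀ t ∈ Icc 0 R, |Φ k s - Φ k t| ≤ C * √|s - t|)
    (hp : ∀ x ∈ Icc 0 R, Tendsto (fun k => Φ k x) atTop (𝓝 (Ψ x))) :
    TendstoUniformlyOn (fun k x => Φ k ((⌊M k * x⌋₊ : ℝ) / M k)) Ψ atTop (Icc 0 R) := by
  have h1 := tendstoUniformlyOn_of_holder hH hp
  rw [Metric.tendstoUniformlyOn_iff] at h1 ⊢
  intro ε hε
  have h2 := (tendsto_mul_sqrt_zero C (tendsto_inv_atTop_zero.comp hM')).eventually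
    (gt_mem_nhds (half_pos hε))
  filter_upwards [h1 (ε / 2) (half_pos hε), hH, h2] with k hk hHk h2k x hx
  have hle := floor_div_le (hM k) hx.1
  have h3 := hHk x hx _ ⟨floor_div_nonneg (hM k) x, hle.trans hx.2⟩
  have h4 : C * √|x - (⌊M k * x⌋₊ : ℝ) / M k| ≤ C * √((M k)⁻¹) := by
    gcongr
    rw [abs_of_nonneg (sub_nonneg.2 hle)]
    exact sub_floor_div_le (hM k) x
  have h5 := hk x hx
  simp only [Function.comp] at h2k
  have h6 : dist (Φ k x) (Φ k ((⌊M k * x⌋₊ : ℝ) / M k)) < ε / 2 := by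
    rw [Real.dist_eq]
    exact (h3.trans h4).trans_lt h2k
  calc _ ≤ _ := dist_triangle _ (Φ k x) _
    _ < ε := by linarith

theorem CompactUniform.congr {u u' : ℕ → ℝ → ℝ} {g g' : ℝ → ℝ} (h : CompactUniform u g)
    (hu : ∀ k, ∀ x, 0 ≤ x → u k x = u' k x) (hg : ∀ x, 0 ≤ x → g x = g' x) :
    CompactUniform u' g' := fun R =>
  ((h R).congr (Eventually.of_forall fun k x hx => hu k x hx.1)).congr_right
    fun x hx => hg x hx.1

theorem CompactUniform.add {u v : ℕ → ℝ → ℝ} {f g : ℝ → ℝ} (hu : CompactUniform u f)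
    (hv : CompactUniform v g) : CompactUniform (fun k x => u k x + v k x) (fun x => f x + g x) :=
  fun R => (hu R).add (hv R)

theorem CompactUniform.sub {u v : ℕ → ℝ → ℝ} {f g : ℝ → ℝ} (hu : CompactUniform u f)
    (hv : CompactUniform v g) : CompactUniform (fun k x => u k x - v k x) (fun x => f x - g x) :=
  fun R => (hu R).sub (hv R)

theorem CompactUniform.mul {u v : ℕ → ℝ → ℝ} {f g : ℝ → ℝ} (hu : CompactUniform u f)
    (hv : CompactUniform v g) (hf : ContinuousOn f (Ici 0)) (hg : ContinuousOn g (Ici 0)) :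
    CompactUniform (fun k x => u k x * v k x) (fun x => f x * g x) := fun R => by
  have h (x : ℝ) (hx : x ∈ Icc 0 R) : x ∈ Ici (0 : ℝ) := hx.1
  have e (F : ℕ → ℝ → ℝ) (f : ℝ → ℝ) :=
    tendstoLocallyUniformlyOn_iff_tendstoUniformlyOn_of_compact (F := F) (p := atTop) (f := f)
      (isCompact_Icc (a := (0 : ℝ)) (b := R))
  exact (e _ _).1 (((e _ _).2 (hu R)).mul₀ ((e _ _).2 (hv R)) (hf.mono h) (hg.mono h))

theorem CompactUniform.const_mul {u : ℕ → ℝ → ℝ} {f : ℝ → ℝ} (hu : CompactUniform u f)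
    (hf : ContinuousOn f (Ici 0)) (c : ℝ) :
    CompactUniform (fun k x => c * u k x) (fun x => c * f x) :=
  CompactUniform.mul (u := fun _ _ => c) (f := fun _ => c)
    (fun _ => (tendsto_const_nhds (x := c)).tendstoUniformlyOn_const _) hu continuousOn_const hf

theorem CompactUniform.of_tendsto {c : ℕ → ℝ} {d : ℝ} (h : Tendsto c atTop (𝓝 d)) :
    CompactUniform (fun k _ => c k) (fun _ => d) :=
  fun _ => h.tendstoUniformlyOn_const _

/-- A shift of the index is a translation by `1 / M k`, harmless because the limit is uniformly
continuous on compact sets. -/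
theorem CompactUniform.gridFn_succ {M : ℕ → ℝ} (hM : ∀ k, 0 < M k) (hM' : Tendsto M atTop atTop)
    {a : ℕ → ℕ → ℝ} {α : ℝ → ℝ} (h : CompactUniform (fun k => gridFn (M k) (a k)) α)
    (hα : ContinuousOn α (Ici 0)) :
    CompactUniform (fun k => gridFn (M k) (fun i => a k (i + 1))) α := fun R => by
  have hu : UniformContinuousOn α (Icc 0 (R + 1)) :=
    isCompact_Icc.uniformContinuousOn_of_continuous (hα.mono fun x hx => hx.1)
  have h1 := Metric.tendstoUniformlyOn_iff.1 (h (R + 1))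
  rw [Metric.tendstoUniformlyOn_iff]
  intro ε hε
  obtain ⟨δ, hδ, hδα⟩ := Metric.uniformContinuousOn_iff.1 hu (ε / 2) (half_pos hε)
  -- The bound by `1` keeps the translated point inside `[0, R + 1]`.
  have h2 := (tendsto_inv_atTop_zero.comp hM').eventually
    (gt_mem_nhds (lt_min hδ (zero_lt_one (α := ℝ))))
  filter_upwards [h1 (ε / 2) (half_pos hε), h2] with k hk h2k x hx
  simp only [Function.comp, lt_min_iff] at h2k
  have hi := inv_pos.2 (hM k)
  have hx' : x + (M k)⁻¹ ∈ Icc 0 (R + 1) := ⟨by linarith [hx.1], by linarith [hx.2]⟩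
  rw [SpikedTridiagonal.gridFn_succ (hM k) _ hx.1]
  have h3 := hδα x ⟨hx.1, by linarith [hx.2]⟩ _ hx' (by
    rw [Real.dist_eq, sub_add_cancel_left, abs_neg, abs_of_pos hi]
    exact h2k.1)
  have h4 := hk _ hx'
  calc _ ≤ _ := dist_triangle _ (α (x + (M k)⁻¹)) _
    _ < ε := by linarith

theorem CompactUniform.eventually_abs_le {u : ℕ → ℝ → ℝ} {f : ℝ → ℝ} (hu : CompactUniform u f)
    (hf : ContinuousOn f (Ici 0)) (R : ℝ) :
    ∃ K, 0 ≤ K ∧ (∀ x ∈ Icc 0 R, |f x| ≤ K) ∧ ∀ᶠ k in atTop, ∀ x ∈ Icc 0 R, |u k x| ≤ K := by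
  obtain ⟨K, hK⟩ := (isCompact_Icc (a := (0 : ℝ)) (b := R)).exists_bound_of_continuousOn
    (hf.mono fun x hx => hx.1)
  refine ⟨|K| + 1, by positivity, fun x hx => ?_, ?_⟩
  · have := hK x hx
    rw [Real.norm_eq_abs] at this
    linarith [le_abs_self K]
  · filter_upwards [Metric.tendstoUniformlyOn_iff.1 (hu R) 1 one_pos] with k hk x hx
    have h1 := hk x hx
    have h2 := hK x hx
    rw [Real.dist_eq, abs_sub_comm] at h1
    rw [Real.norm_eq_abs] at h2
    have h3 := abs_sub_abs_le_abs_sub (u k x) (f x)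
    linarith [le_abs_self K]

/-! ### Weak convergence -/

theorem eLpNorm_two_le {u : ℝ → ℝ} {μ : Measure ℝ} (hu : MemLp u 2 μ) {C : ℝ} (hC : 0 ≤ C)
    (h : ∫ x, u x ^ 2 ∂μ ≤ C ^ 2) : eLpNorm u 2 μ ≤ ENNReal.ofReal C := by
  rw [hu.eLpNorm_eq_integral_rpow_norm (by norm_num) (by norm_num)]
  refine ENNReal.ofReal_le_ofReal ?_
  have e : ∀ x, ‖u x‖ ^ (2 : ENNReal).toReal = u x ^ 2 := fun x => by simp
  simp_rw [e]
  rw [ENNReal.toReal_ofNat, ← one_div, ← Real.sqrt_eq_rpow]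
  exact Real.sqrt_le_iff.2 ⟨hC, h⟩

/-- Sequential Banach–Alaoglu in the dual of the separable space `L²`, carried back to functions by
the Riesz isometry. -/
theorem exists_subseq_weakL2 {u : ℕ → ℝ → ℝ} (hu : ∀ k, MemLp (u k) 2 halfLine) {C : ℝ}
    (hC : 0 ≤ C) (hb : ∀ k, ∫ x, u k x ^ 2 ∂halfLine ≤ C ^ 2) :
    ∃ g, ∃ ψ : ℕ → ℕ, StrictMono ψ ∧ WeakL2 (fun k => u (ψ k)) g := by
  have : IsSeparable halfLine := by unfold halfLine; infer_instance
  have : Fact ((2 : ENNReal) ≠ ⊤) := ⟨by norm_num⟩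
  let E := Lp ℝ 2 halfLine
  let U : ℕ → WeakDual ℝ E := fun k =>
    WeakDual.toStrongDual.symm (InnerProductSpace.toDual ℝ E ((hu k).toLp (u k)))
  have hmem : ∀ k, U k ∈ WeakDual.toStrongDual ⁻¹' Metric.closedBall (0 : StrongDual ℝ E) C := by
    intro k
    simp only [U, mem_preimage, LinearEquiv.apply_symm_apply, mem_closedBall_zero_iff,
      LinearIsometryEquiv.norm_map]
    refine (Lp.norm_toLp (u k) (hu k)).le.trans ?_
    exact ENNReal.toReal_le_of_le_ofReal hC (eLpNorm_two_le (hu k) hC (hb k))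
  obtain ⟨ℓ, -, ψ, hψ, hlim⟩ := WeakDual.isSeqCompact_closedBall ℝ E 0 C hmem
  let g : E := (InnerProductSpace.toDual ℝ E).symm (WeakDual.toStrongDual ℓ)
  have hinner (f h : E) : inner ℝ f h = ∫ x, f x * h x ∂halfLine := by
    rw [L2.inner_def]
    refine integral_congr_ae (Eventually.of_forall fun x => ?_)
    simp [mul_comm]
  refine ⟨g, ψ, hψ, Lp.memLp g, fun h hh => ?_⟩
  have h1 : Tendsto (fun k => U (ψ k) (hh.toLp h)) atTop (𝓝 (ℓ (hh.toLp h))) :=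
    ((WeakDual.eval_continuous (hh.toLp h)).tendsto ℓ).comp hlim
  have e1 : ∀ k, U k (hh.toLp h) = ∫ x, u k x * h x ∂halfLine := fun k => by
    have : U k (hh.toLp h) = inner ℝ ((hu k).toLp (u k)) (hh.toLp h) := rfl
    rw [this, hinner]
    refine integral_congr_ae ?_
    filter_upwards [(hu k).coeFn_toLp, hh.coeFn_toLp] with x h1 h2
    rw [h1, h2]
  have e2 : ℓ (hh.toLp h) = ∫ x, g x * h x ∂halfLine := by
    have : ℓ (hh.toLp h) = inner ℝ g (hh.toLp h) := by
      rw [InnerProductSpace.toDual_symm_apply]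
      rfl
    rw [this, hinner]
    refine integral_congr_ae ?_
    filter_upwards [hh.coeFn_toLp] with x h2
    rw [h2]
  simpa only [e1, e2] using h1

theorem WeakL2.subseq {u : ℕ → ℝ → ℝ} {g : ℝ → ℝ} (h : WeakL2 u g) {ψ : ℕ → ℕ}
    (hψ : StrictMono ψ) : WeakL2 (fun k => u (ψ k)) g :=
  ⟨h.1, fun f hf => (h.2 f hf).comp hψ.tendsto_atTop⟩

theorem WeakL2.congr {u u' : ℕ → ℝ → ℝ} {g g' : ℝ → ℝ} (h : WeakL2 u g)
    (hu : ∀ k, u k =ᵐ[halfLine] u' k) (hg : g =ᵐ[halfLine] g') : WeakL2 u' g' := by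
  refine ⟨(memLp_congr_ae hg).1 h.1, fun f hf => ?_⟩
  have e1 (k : ℕ) : ∫ x, u' k x * f x ∂halfLine = ∫ x, u k x * f x ∂halfLine :=
    integral_congr_ae ((hu k).symm.mul EventuallyEq.rfl)
  have e2 : ∫ x, g' x * f x ∂halfLine = ∫ x, g x * f x ∂halfLine :=
    integral_congr_ae (hg.symm.mul EventuallyEq.rfl)
  simp_rw [e1, e2]
  exact h.2 f hf

theorem integral_halfLine_indicator {x : ℝ} (hx : 0 ≤ x) (f g : ℝ → ℝ) :
    ∫ t, f t * (Ioc 0 x).indicator g t ∂halfLine = ∫ t in (0 : ℝ)..x, g t * f t := by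
  have e : (fun t => f t * (Ioc 0 x).indicator g t) = (Ioc 0 x).indicator (fun t => g t * f t) := by
    funext t
    by_cases h : t ∈ Ioc 0 x <;> simp [h, mul_comm]
  rw [e, integral_indicator measurableSet_Ioc, intervalIntegral.integral_of_le hx, halfLine,
    Measure.restrict_restrict_of_subset fun t ht => ht.1.le]

theorem WeakL2.tendsto_integral_mul {u : ℕ → ℝ → ℝ} {g : ℝ → ℝ} (h : WeakL2 u g) {y : ℝ → ℝ}
    (hy : ContinuousOn y (Ici 0)) {x : ℝ} (hx : 0 ≤ x) :
    Tendsto (fun k => ∫ t in (0 : ℝ)..x, y t * u k t) atTop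
      (𝓝 (∫ t in (0 : ℝ)..x, y t * g t)) := by
  -- The test function is `y` cut off to `(0, x]`, which is bounded with bounded support.
  have hmem : MemLp ((Ioc 0 x).indicator y) 2 halfLine := by
    rw [memLp_indicator_iff_restrict measurableSet_Ioc, halfLine,
      Measure.restrict_restrict_of_subset fun t ht => ht.1.le]
    have hy' : ContinuousOn y (Icc 0 x) := hy.mono fun t ht => ht.1
    obtain ⟨K, hK⟩ := isCompact_Icc.exists_bound_of_continuousOn hy'
    refine MemLp.of_bound ((hy'.mono Ioc_subset_Icc_self).aestronglyMeasurable
      measurableSet_Ioc) K ?_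
    exact (ae_restrict_iff' measurableSet_Ioc).2
      (Eventually.of_forall fun t ht => hK t (Ioc_subset_Icc_self ht))
  simpa only [integral_halfLine_indicator hx] using h.2 _ hmem

theorem WeakL2.tendsto_integral {u : ℕ → ℝ → ℝ} {g : ℝ → ℝ} (h : WeakL2 u g) {x : ℝ}
    (hx : 0 ≤ x) :
    Tendsto (fun k => ∫ t in (0 : ℝ)..x, u k t) atTop (𝓝 (∫ t in (0 : ℝ)..x, g t)) := by
  simpa using h.tendsto_integral_mul (y := fun _ => 1) continuousOn_const hx

/-- Replacing `Z k` by `y` costs at most `sup |Z k - y|` on `[0,x]` times the `L¹` norm of `u k`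
there, which Cauchy–Schwarz bounds by `C √x`. -/
theorem WeakL2.tendsto_integral_mul_compactUniform {u Z : ℕ → ℝ → ℝ} {g y : ℝ → ℝ} (h : WeakL2 u g)
    (hu : ∀ k, MemLp (u k) 2 halfLine) {C : ℝ} (hC : 0 ≤ C)
    (hb : ∀ k, ∫ x, u k x ^ 2 ∂halfLine ≤ C ^ 2) (hy : ContinuousOn y (Ici 0))
    (hZm : ∀ k, Measurable (Z k)) (hZ : CompactUniform Z y) {x : ℝ} (hx : 0 ≤ x) :
    Tendsto (fun k => ∫ t in (0 : ℝ)..x, Z k t * u k t) atTop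
      (𝓝 (∫ t in (0 : ℝ)..x, y t * g t)) := by
  refine (h.tendsto_integral_mul hy hx).congr_dist ?_
  obtain ⟨K, hK, hyK, hZK⟩ := hZ.eventually_abs_le hy x
  rw [Metric.tendsto_nhds]
  intro ε hε
  have hc : 0 < C * √x + 1 := by positivity
  filter_upwards [hZK, Metric.tendstoUniformlyOn_iff.1 (hZ x) (ε / (C * √x + 1)) (by positivity)]
    with k hk hk'
  have h0 : (0 : ℝ) ∈ Icc 0 x := ⟨le_rfl, hx⟩
  have hx' : x ∈ Icc 0 x := ⟨hx, le_rfl⟩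
  have hui := intervalIntegrable_of_memLp (hu k) le_rfl hx
  have hi1 := intervalIntegrable_mul_of_memLp (hu k) (hZm k) hk h0 hx'
  have hi2 : IntervalIntegrable (fun t => y t * u k t) volume 0 x :=
    hui.continuousOn_mul (hy.mono fun t ht => by rw [uIcc_of_le hx] at ht; exact ht.1)
  rw [Real.dist_eq, sub_zero, abs_of_nonneg dist_nonneg, Real.dist_eq,
    ← intervalIntegral.integral_sub hi2 hi1]
  calc |∫ t in (0 : ℝ)..x, (y t * u k t - Z k t * u k t)|
      ≤ ∫ t in (0 : ℝ)..x, |y t * u k t - Z k t * u k t| :=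
        intervalIntegral.abs_integral_le_integral_abs hx
    _ ≤ ∫ t in (0 : ℝ)..x, ε / (C * √x + 1) * |u k t| := by
        refine intervalIntegral.integral_mono_on hx (hi2.sub hi1).abs (hui.abs.const_mul _)
          fun t ht => ?_
        rw [← sub_mul, abs_mul]
        gcongr
        exact (hk' t ht).le
    _ = ε / (C * √x + 1) * ∫ t in (0 : ℝ)..x, |u k t| := intervalIntegral.integral_const_mul _ _
    _ ≤ ε / (C * √x + 1) * (C * √x) := by
        gcongr
        simpa using integral_abs_le_of_memLp (hu k) hC (hb k) le_rfl hx
    _ < ε := by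
        rw [div_mul_eq_mul_div, div_lt_iff₀ hc]
        nlinarith

/-! ### Strong convergence from a confining weight -/

/-- Beyond `R` the weight is at least `ρ R`, so the tails of `u k - f` are uniformly of order `1 / ρ
R`; on `[0,R]` uniform convergence suffices. -/
theorem strongL2_of_weight {u : ℕ → ℝ → ℝ} {f ρ : ℝ → ℝ}
    (hu : ∀ k, AEStronglyMeasurable (u k) halfLine)
    (hρ : ContinuousOn ρ (Ici 0)) (hρ1 : ∀ x, 0 ≤ x → 1 ≤ ρ x) (hρm : MonotoneOn ρ (Ici 0))
    (hρt : Tendsto ρ atTop atTop) {C : ℝ} (hC : 0 ≤ C)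
    (hb : ∀ k, eLpNorm (fun x => ρ x * u k x) 2 halfLine ≤ ENNReal.ofReal C)
    (hf : ContinuousOn f (Ici 0)) (h : CompactUniform u f) : StrongL2 u f := by
  have hfm : AEStronglyMeasurable f halfLine := hf.aestronglyMeasurable measurableSet_Ici
  have hρmeas : AEStronglyMeasurable ρ halfLine := hρ.aestronglyMeasurable measurableSet_Ici
  -- Fatou: the weighted bound passes to the pointwise limit.
  have hρf : eLpNorm (fun x => ρ x * f x) 2 halfLine ≤ ENNReal.ofReal C := by
    refine Lp.eLpNorm_le_of_ae_tendsto (u := atTop) (Eventually.of_forall hb)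
      (fun k => hρmeas.mul (hu k)) ?_
    filter_upwards [ae_halfLine_nonneg] with x hx
    exact ((h x).tendsto_at ⟨hx, le_rfl⟩).const_mul (ρ x)
  refine ⟨⟨hfm, lt_of_le_of_lt (eLpNorm_mono_ae (g := fun x => ρ x * f x) ?_)
    (hρf.trans_lt ENNReal.ofReal_lt_top)⟩, ?_⟩
  · filter_upwards [ae_halfLine_nonneg] with x hx
    rw [norm_mul]
    exact le_mul_of_one_le_left (norm_nonneg _) ((hρ1 x hx).trans (le_abs_self _))
  have hdiff (k : ℕ) : eLpNorm (fun x => ρ x * (u k x - f x)) 2 halfLine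
      ≤ ENNReal.ofReal (2 * C) := by
    have e : (fun x => ρ x * (u k x - f x)) = (fun x => ρ x * u k x) - fun x => ρ x * f x := by
      funext x; simp [mul_sub]
    rw [e, two_mul, ENNReal.ofReal_add hC hC]
    exact (eLpNorm_sub_le (hρmeas.mul (hu k)) (hρmeas.mul hfm) (by norm_num)).trans
      (add_le_add (hb k) hρf)
  have htail (k : ℕ) {R : ℝ} (hR : 0 ≤ R) :
      eLpNorm ((Ioi R).indicator (u k - f)) 2 halfLine ≤ ENNReal.ofReal (2 * C / ρ R) := by
    have hρR : 0 < ρ R := one_pos.trans_le (hρ1 R hR)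
    have : eLpNorm ((Ioi R).indicator (u k - f)) 2 halfLine ≤ ENNReal.ofReal (ρ R)⁻¹ *
        eLpNorm (fun x => ρ x * (u k x - f x)) 2 halfLine := by
      refine eLpNorm_le_mul_eLpNorm_of_ae_le_mul (Eventually.of_forall fun x => ?_) 2
      by_cases hx : x ∈ Ioi R
      · rw [indicator_of_mem hx, norm_mul, ← mul_assoc, Pi.sub_apply]
        refine le_mul_of_one_le_left (norm_nonneg _) ?_
        rw [inv_mul_eq_div, one_le_div hρR]
        exact (hρm hR (hR.trans (le_of_lt hx)) (le_of_lt hx)).trans (le_abs_self _)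
      · rw [indicator_of_notMem hx, norm_zero]
        positivity
    refine this.trans ?_
    rw [div_eq_inv_mul, ENNReal.ofReal_mul (by positivity)]
    gcongr
    exact hdiff k
  have hbody {R ε : ℝ} (hR : 0 ≤ R) (hε : 0 < ε) :
      ∀ᶠ k in atTop, eLpNorm ((Icc 0 R).indicator (u k - f)) 2 halfLine ≤ ENNReal.ofReal ε := by
    filter_upwards [Metric.tendstoUniformlyOn_iff.1 (h R) (ε / (√R + 1)) (by positivity)] with k hk
    rw [eLpNorm_indicator_eq_eLpNorm_restrict measurableSet_Icc, halfLine,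
      Measure.restrict_restrict_of_subset fun t ht => ht.1]
    refine (eLpNorm_le_of_ae_bound (C := ε / (√R + 1)) ?_).trans ?_
    · refine (ae_restrict_iff' measurableSet_Icc).2 (Eventually.of_forall fun x hx => ?_)
      rw [Pi.sub_apply, ← dist_eq_norm, dist_comm]
      exact (hk x hx).le
    · rw [Measure.restrict_apply_univ, Real.volume_Icc, sub_zero,
        ENNReal.ofReal_rpow_of_nonneg hR (by simp), ← ENNReal.ofReal_mul (by positivity)]
      refine ENNReal.ofReal_le_ofReal ?_
      rw [ENNReal.toReal_ofNat, ← one_div, ← Real.sqrt_eq_rpow, mul_div_assoc', div_le_iff₀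
        (by positivity)]
      nlinarith [Real.sqrt_nonneg R]
  rw [ENNReal.tendsto_nhds_zero]
  intro δ hδ
  obtain ⟨ε, hε, hεδ⟩ : ∃ ε : ℝ, 0 < ε ∧ ENNReal.ofReal (ε + ε) ≤ δ := by
    rcases eq_or_ne δ ⊤ with rfl | hδt
    · exact ⟨1, one_pos, le_top⟩
    · refine ⟨δ.toReal / 2, half_pos (ENNReal.toReal_pos hδ.ne' hδt), ?_⟩
      rw [add_halves, ENNReal.ofReal_toReal hδt]
  obtain ⟨R, hR, hR'⟩ : ∃ R, 0 ≤ R ∧ 2 * C / ρ R ≤ ε := by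
    have ht : Tendsto (fun R => 2 * C / ρ R) atTop (𝓝 0) := hρt.const_div_atTop _
    obtain ⟨R, h1, h2⟩ := ((eventually_ge_atTop 0).and (ht.eventually (gt_mem_nhds hε))).exists
    exact ⟨R, h1, h2.le⟩
  filter_upwards [hbody hR hε] with k hk
  have hsplit : u k - f =ᵐ[halfLine]
      (Icc 0 R).indicator (u k - f) + (Ioi R).indicator (u k - f) := by
    filter_upwards [ae_halfLine_nonneg] with x hx
    rw [Pi.add_apply]
    rcases le_or_gt x R with hxR | hxR
    · rw [indicator_of_mem (show x ∈ Icc 0 R from ⟨hx, hxR⟩),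
        indicator_of_notMem (show x ∉ Ioi R from not_lt.2 hxR), add_zero]
    · rw [indicator_of_mem (show x ∈ Ioi R from hxR),
        indicator_of_notMem (show x ∉ Icc 0 R from fun h => (h.2.trans_lt hxR).false), zero_add]
  rw [eLpNorm_congr_ae hsplit]
  have hm := (hu k).sub hfm
  refine (eLpNorm_add_le (hm.indicator measurableSet_Icc) (hm.indicator measurableSet_Ioi)
    (by norm_num)).trans (le_trans ?_ hεδ)
  rw [ENNReal.ofReal_add hε.le hε.le]
  exact add_le_add hk ((htail k hR).trans (ENNReal.ofReal_le_ofReal hR'))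

/-! ### Primitives on the half line -/

theorem absolutelyContinuousOnInterval_congr {f g : ℝ → ℝ} {a b : ℝ} (h : EqOn f g (uIcc a b))
    (hf : AbsolutelyContinuousOnInterval f a b) : AbsolutelyContinuousOnInterval g a b := by
  rw [absolutelyContinuousOnInterval_iff] at hf ⊢
  intro ε hε
  obtain ⟨δ, hδ, H⟩ := hf ε hε
  refine ⟨δ, hδ, fun E hE hlt => ?_⟩
  convert H E hE hlt using 1
  refine Finset.sum_congr rfl fun i hi => ?_
  obtain ⟨h1, h2⟩ := hE.1 i hi
  rw [h h1, h h2]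

/-- Lebesgue differentiation on each `[0,n]`; countably many intervals allow a single exceptional
null set. -/
theorem ae_hasDerivAt_primitive {q : ℝ → ℝ} (hq : ∀ R, 0 ≤ R → IntervalIntegrable q volume 0 R) :
    ∀ᵐ x ∂halfLine, HasDerivAt (fun x => ∫ t in (0 : ℝ)..x, q t) (q x) x := by
  have h : ∀ᵐ x, ∀ n : ℕ, x ∈ uIcc 0 (n : ℝ) → ∀ c ∈ uIcc 0 (n : ℝ),
      HasDerivAt (fun x => ∫ t in c..x, q t) (q x) x :=
    ae_all_iff.2 fun n => (hq n n.cast_nonneg).ae_hasDerivAt_integral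
  filter_upwards [ae_halfLine_nonneg, ae_mono Measure.restrict_le_self h] with x hx hx'
  obtain ⟨n, hn⟩ := exists_nat_ge x
  exact hx' n (by rw [uIcc_of_le n.cast_nonneg]; exact ⟨hx, hn⟩) 0 left_mem_uIcc

theorem halfDeriv_eq_of_hasDerivAt {f g : ℝ → ℝ} (hfg : ∀ x, 0 ≤ x → f x = g x) {x d : ℝ}
    (hx : 0 ≤ x) (h : HasDerivAt g d x) : halfDeriv f x = d :=
  ((h.hasDerivWithinAt (s := Ici 0)).congr (fun y hy => hfg y hy) (hfg x hx)).derivWithin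
    (uniqueDiffOn_Ici 0 x hx)

theorem halfDeriv_primitive_ae {f q : ℝ → ℝ} {c : ℝ}
    (hq : ∀ R, 0 ≤ R → IntervalIntegrable q volume 0 R)
    (hf : ∀ x, 0 ≤ x → f x = c + ∫ t in (0 : ℝ)..x, q t) : halfDeriv f =ᵐ[halfLine] q := by
  filter_upwards [ae_halfLine_nonneg, ae_hasDerivAt_primitive hq] with x hx h
  exact halfDeriv_eq_of_hasDerivAt hf hx (h.const_add c)

theorem inH1Loc_primitive {f q : ℝ → ℝ} {c : ℝ}
    (hq : ∀ R, 0 ≤ R → MemLp q 2 (volume.restrict (Icc 0 R)))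
    (hf : ∀ x, 0 ≤ x → f x = c + ∫ t in (0 : ℝ)..x, q t) : InH1Loc f := by
  have hqi : ∀ R, 0 ≤ R → IntervalIntegrable q volume 0 R := fun R hR =>
    (intervalIntegrable_iff_integrableOn_Icc_of_le hR).2 ((hq R hR).integrable (by norm_num))
  intro R hR
  constructor
  · have h1 : AbsolutelyContinuousOnInterval (fun _ : ℝ => c) 0 R :=
      contDiffOn_const.absolutelyContinuousOnInterval
    have h2 := (hqi R hR.le).absolutelyContinuousOnInterval_intervalIntegral left_mem_uIcc
    refine absolutelyContinuousOnInterval_congr (fun x hx => ?_) (h1.add h2)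
    rw [uIcc_of_le hR.le] at hx
    exact (hf x hx.1).symm
  · exact (memLp_congr_ae (ae_mono (restrict_Icc_le_halfLine le_rfl R)
      (halfDeriv_primitive_ae hqi hf))).2 (hq R hR.le)

theorem intervalIntegrable_continuousOn_mul {y g : ℝ → ℝ} (hy : ContinuousOn y (Ici 0))
    (hg : MemLp g 2 halfLine) {R : ℝ} (hR : 0 ≤ R) :
    IntervalIntegrable (fun t => y t * g t) volume 0 R :=
  (intervalIntegrable_of_memLp hg le_rfl hR).continuousOn_mul
    (hy.mono fun t ht => by rw [uIcc_of_le hR] at ht; exact ht.1)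

theorem continuousOn_primitive_halfLine {q : ℝ → ℝ}
    (hq : ∀ R, 0 ≤ R → IntervalIntegrable q volume 0 R) :
    ContinuousOn (fun x => ∫ t in (0 : ℝ)..x, q t) (Ici 0) := by
  intro x hx
  have hx1 : 0 ≤ x + 1 := add_nonneg hx zero_le_one
  have h := intervalIntegral.continuousOn_primitive_interval' (hq (x + 1) hx1) left_mem_uIcc
  rw [uIcc_of_le hx1] at h
  refine (h x ⟨hx, by linarith⟩).mono_of_mem_nhdsWithin ?_
  filter_upwards [self_mem_nhdsWithin,
    mem_nhdsWithin_of_mem_nhds (Iio_mem_nhds (show x < x + 1 by linarith))] with t h0 h1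
  exact ⟨h0, le_of_lt h1⟩

theorem CompactUniform.tendsto_integral {u : ℕ → ℝ → ℝ} {f : ℝ → ℝ} (h : CompactUniform u f)
    {x : ℝ} (hx : 0 ≤ x) (hu : ∀ k, IntervalIntegrable (u k) volume 0 x)
    (hf : ContinuousOn f (Ici 0)) :
    Tendsto (fun k => ∫ t in (0 : ℝ)..x, u k t) atTop (𝓝 (∫ t in (0 : ℝ)..x, f t)) := by
  rw [Metric.tendsto_nhds]
  intro ε hε
  have hfi : IntervalIntegrable f volume 0 x :=
    (hf.mono fun t ht => by rw [uIcc_of_le hx] at ht; exact ht.1).intervalIntegrable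
  filter_upwards [Metric.tendstoUniformlyOn_iff.1 (h x) (ε / (x + 1)) (by positivity)] with k hk
  rw [dist_eq_norm, ← intervalIntegral.integral_sub (hu k) hfi]
  refine (intervalIntegral.norm_integral_le_of_norm_le_const (C := ε / (x + 1))
    fun t ht => ?_).trans_lt ?_
  · rw [uIoc_of_le hx] at ht
    rw [← dist_eq_norm, dist_comm]
    exact (hk t ⟨ht.1.le, ht.2⟩).le
  · rw [sub_zero, abs_of_nonneg hx, div_mul_eq_mul_div, div_lt_iff₀ (by positivity)]
    nlinarith

/-! ### Limits of discrete integrals and of the summation by parts -/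

theorem integral_gridFn_mul_stepFn {m : ℝ} (hm : 0 < m) (a : ℕ → ℝ) {n : ℕ} (v : Fin n → ℝ)
    (j : ℕ) : ∫ x in (0 : ℝ)..(j : ℝ) / m, gridFn m a x * stepFn m v x
      = m⁻¹ * ∑ i ∈ Finset.range j, a i * zeroExt v i := by
  rw [← (integral_gridFn hm (fun i => a i * zeroExt v i) j).2]
  refine intervalIntegral.integral_congr fun x hx => ?_
  rw [uIcc_of_le (by positivity)] at hx
  simp only [stepFn_eq_gridFn hm v hx.1]
  rfl

theorem compactUniform_gridFn {M : ℕ → ℝ} (hM : ∀ k, 0 < M k) {n : ℕ → ℕ}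
    {v : (k : ℕ) → Fin (n k) → ℝ} {f : ℝ → ℝ} (h : CompactUniform (fun k => stepFn (M k) (v k)) f) :
    CompactUniform (fun k => gridFn (M k) (zeroExt (v k))) f :=
  h.congr (fun k _ hx => stepFn_eq_gridFn (hM k) _ hx) fun _ _ => rfl

theorem compactUniform_stepFn {M : ℕ → ℝ} (hM : ∀ k, 0 < M k) {n : ℕ → ℕ}
    {v : (k : ℕ) → Fin (n k) → ℝ} {f : ℝ → ℝ}
    (h : CompactUniform (fun k => gridFn (M k) (zeroExt (v k))) f) :
    CompactUniform (fun k => stepFn (M k) (v k)) f :=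
  h.congr (fun k _ hx => (stepFn_eq_gridFn (hM k) _ hx).symm) fun _ _ => rfl

theorem integral_stepFn_sq_le {m : ℝ} (hm : 0 < m) {n : ℕ} {v : Fin n → ℝ} {C : ℝ}
    (h : vecNorm m v ≤ C) : ∫ x, stepFn m v x ^ 2 ∂halfLine ≤ C ^ 2 := by
  rw [integral_stepFn_sq hm]
  exact pow_le_pow_left₀ (Real.sqrt_nonneg _) h 2

/-- Each sum is exactly the integral of `gridFn` times `stepFn` up to a mesh point, so weak
convergence gives the pointwise limit and the Hölder modulus makes it uniform. -/
theorem compactUniform_partial_sums {M : ℕ → ℝ} (hM : ∀ k, 0 < M k) (hM' : Tendsto M atTop atTop)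
    {n : ℕ → ℕ} {v : (k : ℕ) → Fin (n k) → ℝ} {C : ℝ} (hC : 0 ≤ C)
    (hv : ∀ k, vecNorm (M k) (v k) ≤ C) {G : ℝ → ℝ}
    (hG : WeakL2 (fun k => stepFn (M k) (v k)) G) {a : ℕ → ℕ → ℝ} {y : ℝ → ℝ}
    (ha : CompactUniform (fun k => gridFn (M k) (a k)) y) (hy : ContinuousOn y (Ici 0)) :
    CompactUniform
      (fun k x => (M k)⁻¹ * ∑ i ∈ Finset.range ⌊M k * x⌋₊, a k i * zeroExt (v k) i)
      (fun x => ∫ t in (0 : ℝ)..x, y t * G t) := fun R => by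
  obtain ⟨K, hK, -, haK⟩ := ha.eventually_abs_le hy R
  have hb k := integral_stepFn_sq_le (hM k) (hv k)
  have := tendstoUniformlyOn_floor_of_holder (M := M) (R := R) (C := K * C)
    (Φ := fun k x => ∫ t in (0 : ℝ)..x, gridFn (M k) (a k) t * stepFn (M k) (v k) t)
    (Ψ := fun x => ∫ t in (0 : ℝ)..x, y t * G t) (by positivity) hM hM'
    (haK.mono fun k hk s hs t ht => abs_integral_mul_sub_le (memLp_stepFn _ _) hC (hb k)
      (measurable_gridFn _ _) hk hs ht)
    fun x hx => hG.tendsto_integral_mul_compactUniform (fun k => memLp_stepFn _ _) hC hb hy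
      (fun k => measurable_gridFn _ _) ha hx.1
  simpa only [integral_gridFn_mul_stepFn (hM _)] using this

theorem compactUniform_of_weak_diffQ {M : ℕ → ℝ} (hM : ∀ k, 0 < M k) (hM' : Tendsto M atTop atTop)
    {n : ℕ → ℕ} {v : (k : ℕ) → Fin (n k) → ℝ} {C : ℝ} (hC : 0 ≤ C)
    (hv : ∀ k, vecNorm (M k) (diffQ (M k) (v k)) ≤ C) {G : ℝ → ℝ}
    (hG : WeakL2 (fun k => stepFn (M k) (diffQ (M k) (v k))) G) {c : ℝ}
    (hc : Tendsto (fun k => zeroExt (v k) 0) atTop (𝓝 c)) :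
    CompactUniform (fun k => stepFn (M k) (v k)) (fun x => c + ∫ t in (0 : ℝ)..x, G t) := by
  have h1 : CompactUniform (fun k => gridFn (M k) (fun _ => 1)) (fun _ => 1) :=
    CompactUniform.of_tendsto tendsto_const_nhds
  have h2 := compactUniform_partial_sums hM hM' hC hv hG h1 continuousOn_const
  refine compactUniform_stepFn hM (((CompactUniform.of_tendsto hc).add h2).congr ?_ ?_)
  · intro k x _
    simp only [one_mul, gridFn]
    exact (zeroExt_eq_sum_diffQ (hM k) (v k) _).symm
  · intro x _
    simp only [one_mul]

/-- Shifted sequences have the same limits as unshifted ones, so the increment of `b` drops out and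
both factor orders give the same limit. -/
theorem compactUniform_boundaryTerm (o : FactorOrder) {M : ℕ → ℝ} (hM : ∀ k, 0 < M k)
    (hM' : Tendsto M atTop atTop) {a b v : ℕ → ℕ → ℝ} {α β f : ℝ → ℝ}
    (hα : ContinuousOn α (Ici 0)) (hβ : ContinuousOn β (Ici 0)) (hf : ContinuousOn f (Ici 0))
    (ha : CompactUniform (fun k => gridFn (M k) (a k)) α)
    (hb : CompactUniform (fun k => gridFn (M k) (b k)) β)
    (hv : CompactUniform (fun k => gridFn (M k) (v k)) f) :
    CompactUniform (fun k => gridFn (M k) (boundaryTerm o (a k) (b k) (v k)))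
      (fun x => (α + β) x * f x) := by
  have ha' := ha.gridFn_succ hM hM' hα
  have hb' := hb.gridFn_succ hM hM' hβ
  have hv' := hv.gridFn_succ hM hM' hf
  have h1 := ha'.mul hv hα hf
  have h2 := (hb.mul hv hβ hf).add ((hb'.sub hb).mul hv' (hβ.sub hβ) hf)
  have c2 : ContinuousOn (fun x => β x * f x + (β x - β x) * f x + β x * f x) (Ici 0) := by
    fun_prop
  cases o
  · exact (h1.add ((h2.add (hb'.mul hv hβ hf)).const_mul c2 (1 / 2))).congr
      (fun _ _ _ => rfl) fun x _ => by simp only [Pi.add_apply]; ring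
  · exact (h1.add ((h2.add (hb.mul hv hβ hf)).const_mul c2 (1 / 2))).congr
      (fun _ _ _ => rfl) fun x _ => by simp only [Pi.add_apply]; ring

theorem compactUniform_gradientCoeff (o : FactorOrder) {M : ℕ → ℝ} (hM : ∀ k, 0 < M k)
    (hM' : Tendsto M atTop atTop) {a b : ℕ → ℕ → ℝ} {α β : ℝ → ℝ}
    (hα : ContinuousOn α (Ici 0)) (hβ : ContinuousOn β (Ici 0))
    (ha : CompactUniform (fun k => gridFn (M k) (a k)) α)
    (hb : CompactUniform (fun k => gridFn (M k) (b k)) β) :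
    CompactUniform (fun k => gridFn (M k) (gradientCoeff o (a k) (b k))) (α + β) := by
  have ha' := ha.gridFn_succ hM hM' hα
  have hb' := hb.gridFn_succ hM hM' hβ
  have hb'' := hb'.gridFn_succ hM hM' hβ
  have c2 : ContinuousOn (fun x => β x + β x) (Ici 0) := by fun_prop
  cases o
  · exact (ha'.add ((hb.add hb'').const_mul c2 (1 / 2))).congr
      (fun _ _ _ => rfl) fun x _ => by simp only [Pi.add_apply]; ring
  · exact (ha'.add ((hb.add hb').const_mul c2 (1 / 2))).congr
      (fun _ _ _ => rfl) fun x _ => by simp only [Pi.add_apply]; ring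

/-- The summation by parts controls `D v` only up to its initial value, for which no bound is given.
That value is recovered as the integral over `[0,1]` of `D v` minus that of `D v - D v(0)`: the
first converges weakly, the second uniformly. -/
theorem compactUniform_diffQ (o : FactorOrder) {M : ℕ → ℝ} (hM : ∀ k, 0 < M k)
    (hM' : Tendsto M atTop atTop) {n : ℕ → ℕ}
    (hn : ∀ R, ∀ᶠ k in atTop, R * M k + 1 < n k)
    {Y₁ Y₂ : (k : ℕ) → Fin (n k + 1) → ℝ} {w : ℕ → ℝ} {v : (k : ℕ) → Fin (n k) → ℝ}
    {y₁ y₂ f G H : ℝ → ℝ} (hy₁ : ContinuousOn y₁ (Ici 0)) (hy₂ : ContinuousOn y₂ (Ici 0))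
    (hY₁ : CompactUniform (fun k => stepFn (M k) (Y₁ k)) y₁)
    (hY₂ : CompactUniform (fun k => stepFn (M k) (Y₂ k)) y₂) {C : ℝ} (hC : 0 ≤ C)
    (hvC : ∀ k, vecNorm (M k) (diffQ (M k) (v k)) ≤ C)
    (hHC : ∀ k, vecNorm (M k) (reducedH o (M k) (Y₁ k) (Y₂ k) (w k) (v k)) ≤ C)
    (hf : ContinuousOn f (Ici 0)) (hv : CompactUniform (fun k => stepFn (M k) (v k)) f)
    (hG : WeakL2 (fun k => stepFn (M k) (diffQ (M k) (v k))) G)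
    (hH : WeakL2 (fun k => stepFn (M k) (reducedH o (M k) (Y₁ k) (Y₂ k) (w k) (v k))) H) :
    ∃ d : ℝ, CompactUniform (fun k => stepFn (M k) (diffQ (M k) (v k)))
      (fun x => (y₁ + y₂) x * f x
        + (d + ∫ t in (0 : ℝ)..x, (-H t - (y₁ + y₂) t * G t))) := by
  have hy : ContinuousOn (y₁ + y₂) (Ici 0) := hy₁.add hy₂
  have h1 : CompactUniform (fun k => gridFn (M k) (fun _ => 1)) (fun _ => 1) :=
    CompactUniform.of_tendsto tendsto_const_nhds
  have gY₁ := compactUniform_gridFn hM hY₁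
  have gY₂ := compactUniform_gridFn hM hY₂
  have sH := compactUniform_partial_sums hM hM' hC hHC hH h1 continuousOn_const
  have hB := compactUniform_boundaryTerm o hM hM' hy₁ hy₂ hf gY₁ gY₂ (compactUniform_gridFn hM hv)
  have sG := compactUniform_partial_sums hM hM' hC hvC hG
    (compactUniform_gradientCoeff o hM hM' hy₁ hy₂ gY₁ gY₂) hy
  have hB0 := CompactUniform.of_tendsto ((hB 0).tendsto_at ⟨le_rfl, le_rfl⟩)
  set E : ℝ → ℝ := fun x => (y₁ + y₂) x * f x - (y₁ + y₂) 0 * f 0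
    + ∫ t in (0 : ℝ)..x, (-H t - (y₁ + y₂) t * G t) with hE
  have iyG : ∀ R, 0 ≤ R → IntervalIntegrable (fun t => (y₁ + y₂) t * G t) volume 0 R :=
    fun R hR => intervalIntegrable_continuousOn_mul hy hG.1 hR
  have iH : ∀ R, 0 ≤ R → IntervalIntegrable H volume 0 R :=
    fun R hR => intervalIntegrable_of_memLp hH.1 le_rfl hR
  have cE : ContinuousOn E (Ici 0) :=
    ((hy.mul hf).sub continuousOn_const).add
      (continuousOn_primitive_halfLine fun R hR => (iH R hR).neg.sub (iyG R hR))
  have hdiff : CompactUniform (fun k x => stepFn (M k) (diffQ (M k) (v k)) x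
      - zeroExt (diffQ (M k) (v k)) 0) E := by
    have hsum := ((hB.sub hB0).sub sH).sub sG
    intro R
    refine ((hsum R).congr ?_).congr_right ?_
    -- The summation formula is valid only away from the last row; `hn` places all of `[0,R]` in
    -- that range.
    · filter_upwards [hn R] with k hk x hx
      have hj : ⌊M k * x⌋₊ + 1 < n k := by
        have h2 := Nat.floor_le (mul_nonneg (hM k).le hx.1)
        have h3 : M k * x ≤ R * M k := by
          rw [mul_comm]
          exact mul_le_mul_of_nonneg_right hx.2 (hM k).le
        have : ((⌊M k * x⌋₊ + 1 : ℕ) : ℝ) < n k := by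
          push_cast
          linarith
        exact_mod_cast this
      simp only [stepFn_eq_gridFn (hM k) _ hx.1, gridFn_zero, one_mul]
      have := diffQ_sum o (hM k) (Y₁ k) (Y₂ k) (w k) (v k) hj
      simp only [gridFn]
      linarith
    · intro x hx
      simp only [hE, one_mul]
      have iH' : IntervalIntegrable (fun t => -H t) volume 0 x := (iH x hx.1).neg
      rw [intervalIntegral.integral_sub iH' (iyG x hx.1), intervalIntegral.integral_neg]
      ring
  have hint := hdiff.tendsto_integral zero_le_one
    (fun k => (intervalIntegrable_of_memLp (memLp_stepFn _ _) le_rfl zero_le_one).sub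
      intervalIntegrable_const) cE
  have h0 := (hG.tendsto_integral zero_le_one).sub hint
  have e0 (k : ℕ) : (∫ t in (0 : ℝ)..1, stepFn (M k) (diffQ (M k) (v k)) t)
      - (∫ t in (0 : ℝ)..1, (stepFn (M k) (diffQ (M k) (v k)) t
        - zeroExt (diffQ (M k) (v k)) 0)) = zeroExt (diffQ (M k) (v k)) 0 := by
    rw [intervalIntegral.integral_sub
      (intervalIntegrable_of_memLp (memLp_stepFn _ _) le_rfl zero_le_one) intervalIntegrable_const]
    simp
  simp only [e0] at h0
  generalize (∫ t in (0 : ℝ)..1, G t) - ∫ t in (0 : ℝ)..1, E t = e at h0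
  refine ⟨e - (y₁ + y₂) 0 * f 0, (hdiff.add (CompactUniform.of_tendsto h0)).congr
    (fun k x _ => sub_add_cancel _ _) fun x _ => ?_⟩
  simp only [hE]
  ring

/-! ### Regularity of the limit -/

theorem halfDeriv_primitive_of_continuousOn {f g : ℝ → ℝ} {c : ℝ} (hg : ContinuousOn g (Ici 0))
    (hf : ∀ x, 0 ≤ x → f x = c + ∫ t in (0 : ℝ)..x, g t) {x : ℝ} (hx : 0 ≤ x) :
    halfDeriv f x = g x := by
  -- Extending `g` by its value at `0` gives a function continuous on the whole line, so that its
  -- primitive has a two-sided derivative even at `0`.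
  have hcont : Continuous fun t => g (max t 0) :=
    hg.comp_continuous (by fun_prop) fun t => le_max_right t 0
  have h := ((hcont.integral_hasStrictDerivAt 0 x).hasDerivAt).const_add c
  rw [max_eq_left hx] at h
  refine halfDeriv_eq_of_hasDerivAt (fun z hz => ?_) hx h
  rw [hf z hz]
  congr 1
  refine intervalIntegral.integral_congr fun t ht => ?_
  rw [uIcc_of_le hz] at ht
  simp only [max_eq_left ht.1]

/-- Since `f` is also a primitive of the continuous function `D`, its derivative is `D` everywhere,
not just almost everywhere. The term `y f` then cancels in the quasi-derivative, leaving a primitive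
of the locally square integrable `-H - y G`; differentiating it identifies `H`. -/
theorem limit_regularity {y f D G H : ℝ → ℝ} {c d : ℝ} (hy : ContinuousOn y (Ici 0))
    (hG : MemLp G 2 halfLine) (hH : MemLp H 2 halfLine)
    (hf : ∀ x, 0 ≤ x → f x = c + ∫ t in (0 : ℝ)..x, G t)
    (hD : ∀ x, 0 ≤ x → D x = y x * f x + (d + ∫ t in (0 : ℝ)..x, (-H t - y t * G t)))
    (hDc : ContinuousOn D (Ici 0))
    (hGD : ∀ x, 0 ≤ x → ∫ t in (0 : ℝ)..x, G t = ∫ t in (0 : ℝ)..x, D t) :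
    (∀ x, 0 ≤ x → halfDeriv f x = D x) ∧ G =ᵐ[halfLine] D ∧ InH1Loc f ∧
      InH1Loc (quasiDeriv y f) ∧ H =ᵐ[halfLine] contH y f := by
  have hfD : ∀ x, 0 ≤ x → halfDeriv f x = D x := fun x hx =>
    halfDeriv_primitive_of_continuousOn hDc (fun z hz => by rw [hf z hz, hGD z hz]) hx
  have hG' : halfDeriv f =ᵐ[halfLine] G :=
    halfDeriv_primitive_ae (fun R hR => intervalIntegrable_of_memLp hG le_rfl hR) hf
  have hGDae : G =ᵐ[halfLine] D := by
    filter_upwards [ae_halfLine_nonneg, hG'] with x hx h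
    rw [← h, hfD x hx]
  have hq : ∀ x, 0 ≤ x →
      quasiDeriv y f x = d + ∫ t in (0 : ℝ)..x, (-H t - y t * G t) := fun x hx => by
    rw [quasiDeriv, hfD x hx, hD x hx]
    ring
  have hmem : ∀ R, 0 ≤ R →
      MemLp (fun t => -H t - y t * G t) 2 (volume.restrict (Icc 0 R)) := fun R hR => by
    have hy' : ContinuousOn y (Icc 0 R) := hy.mono fun t ht => ht.1
    obtain ⟨K, hK⟩ := isCompact_Icc.exists_bound_of_continuousOn hy'
    have hle := restrict_Icc_le_halfLine le_rfl R
    have hyt : MemLp y ⊤ (volume.restrict (Icc 0 R)) :=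
      memLp_top_of_bound (hy'.aestronglyMeasurable measurableSet_Icc) K
        ((ae_restrict_iff' measurableSet_Icc).2 (Eventually.of_forall hK))
    exact (hH.mono_measure hle).neg.sub ((hG.mono_measure hle).mul hyt)
  refine ⟨hfD, hGDae, inH1Loc_primitive
    (fun R _ => hG.mono_measure (restrict_Icc_le_halfLine le_rfl R)) hf,
    inH1Loc_primitive hmem hq, ?_⟩
  have hqd := halfDeriv_primitive_ae (fun R hR =>
    (intervalIntegrable_iff_integrableOn_Icc_of_le hR).2 ((hmem R hR).integrable (by norm_num))) hq
  filter_upwards [hqd, hG'] with x h1 h2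
  rw [contH, h1, h2]
  ring

/-! ### Consequences of the bound on the weighted norm -/

theorem vecNorm_nonneg (m : ℝ) {n : ℕ} (v : Fin n → ℝ) : 0 ≤ vecNorm m v := Real.sqrt_nonneg _

theorem vecNorm_diffQ_le_starNorm (η : ℝ → ℝ) (m : ℝ) {n : ℕ} (v : Fin n → ℝ) :
    vecNorm m (diffQ m v) ≤ starNorm η m v :=
  Real.le_sqrt_of_sq_le (le_add_of_nonneg_left (integral_nonneg fun _ => sq_nonneg _))

theorem integral_weighted_sq_le (η : ℝ → ℝ) {m : ℝ} {n : ℕ} {v : Fin n → ℝ} {C : ℝ} (hC : 0 ≤ C)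
    (h : starNorm η m v ≤ C) :
    ∫ x, (√(1 + η x) * stepFn m v x) ^ 2 ∂halfLine ≤ C ^ 2 :=
  (le_add_of_nonneg_right (sq_nonneg _)).trans ((Real.sqrt_le_left hC).1 h)

theorem stepFn_eq_zero_of_lt {m : ℝ} (hm : 0 < m) {n : ℕ} (v : Fin n → ℝ) {x : ℝ}
    (hx : (n : ℝ) / m < x) : stepFn m v x = 0 := by
  have h0 : 0 ≤ x := (by positivity : (0 : ℝ) ≤ n / m).trans hx.le
  rw [stepFn_eq_gridFn hm v h0, gridFn, zeroExt, dif_neg]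
  rw [not_lt]
  refine Nat.le_floor ?_
  rw [div_lt_iff₀ hm] at hx
  linarith

/-- The weight may be unbounded, but the step function vanishes beyond `n / m`, and there the weight
can be cut off. -/
theorem memLp_mul_stepFn {ρ : ℝ → ℝ} (hρ : ContinuousOn ρ (Ici 0)) {m : ℝ} (hm : 0 < m) {n : ℕ}
    (v : Fin n → ℝ) : MemLp (fun x => ρ x * stepFn m v x) 2 halfLine := by
  have hc : ContinuousOn ρ (Icc 0 ((n : ℝ) / m)) := hρ.mono fun t ht => ht.1
  obtain ⟨K, hK⟩ := isCompact_Icc.exists_bound_of_continuousOn hc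
  have hb : MemLp ((Icc 0 ((n : ℝ) / m)).indicator ρ) ⊤ halfLine := by
    rw [memLp_indicator_iff_restrict measurableSet_Icc, halfLine,
      Measure.restrict_restrict_of_subset fun t ht => ht.1]
    exact memLp_top_of_bound (hc.aestronglyMeasurable measurableSet_Icc) K
      ((ae_restrict_iff' measurableSet_Icc).2 (Eventually.of_forall hK))
  have hmul : MemLp ((Icc 0 ((n : ℝ) / m)).indicator ρ * stepFn m v) 2 halfLine :=
    (memLp_stepFn m v).mul hb
  refine (memLp_congr_ae ?_).1 hmul
  filter_upwards [ae_halfLine_nonneg] with x hx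
  rcases le_or_gt x ((n : ℝ) / m) with h | h
  · rw [Pi.mul_apply, indicator_of_mem (show x ∈ Icc 0 ((n : ℝ) / m) from ⟨hx, h⟩)]
  · rw [Pi.mul_apply, stepFn_eq_zero_of_lt hm v h, mul_zero, mul_zero]

/-- A discrete trace estimate: on `[0,1]` the entries differ from the first by at most `C`, and the
mean of `|v|` over `[0,1]` is at most `C`. -/
theorem abs_zeroExt_zero_le {m : ℝ} (hm : 0 < m) {n : ℕ} {v : Fin n → ℝ} {C : ℝ} (hC : 0 ≤ C)
    (hv : ∫ x, stepFn m v x ^ 2 ∂halfLine ≤ C ^ 2) (hD : vecNorm m (diffQ m v) ≤ C) :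
    |zeroExt v 0| ≤ 2 * C := by
  have hdiff (j : ℕ) (hj : (j : ℝ) / m ≤ 1) : |zeroExt v j - zeroExt v 0| ≤ C := by
    have h0 : (0 : ℝ) ≤ (j : ℝ) / m := by positivity
    have h := abs_integral_mul_sub_le (memLp_stepFn m (diffQ m v)) hC (integral_stepFn_sq_le hm hD)
      (measurable_gridFn m fun _ => 1) (R := 1) (K := 1) (fun x _ => by simp [gridFn])
      (s := (j : ℝ) / m) (t := 0) ⟨h0, hj⟩ ⟨le_rfl, zero_le_one⟩
    rw [integral_gridFn_mul_stepFn hm, intervalIntegral.integral_same, sub_zero, sub_zero,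
      abs_of_nonneg h0] at h
    simp only [one_mul] at h
    rw [zeroExt_eq_sum_diffQ hm v j, add_sub_cancel_left]
    exact h.trans (mul_le_of_le_one_right hC (Real.sqrt_le_one.2 hj))
  have hpt : ∀ x ∈ Icc (0 : ℝ) 1, |zeroExt v 0| - C ≤ |stepFn m v x| := fun x hx => by
    have h1 := hdiff ⌊m * x⌋₊ ((floor_div_le hm hx.1).trans hx.2)
    rw [stepFn_eq_gridFn hm v hx.1, gridFn]
    have h2 := abs_sub_abs_le_abs_sub (zeroExt v 0) (zeroExt v ⌊m * x⌋₊)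
    rw [abs_sub_comm] at h2
    linarith
  have h1 := intervalIntegral.integral_mono_on zero_le_one intervalIntegrable_const
    (intervalIntegrable_of_memLp (memLp_stepFn m v) le_rfl zero_le_one).abs hpt
  have h2 := integral_abs_le_of_memLp (memLp_stepFn m v) hC hv le_rfl zero_le_one
  rw [intervalIntegral.integral_const, sub_zero, one_smul] at h1
  rw [sub_zero, Real.sqrt_one, mul_one] at h2
  linarith

theorem tendsto_atTop_of_monotoneOn_Ici {η : ℝ → ℝ} (hη : MonotoneOn η (Ici 0))
    (h : ¬ BddAbove (η '' Ici 0)) : Tendsto η atTop atTop := by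
  rw [tendsto_atTop]
  intro b
  obtain ⟨_, ⟨x, hx, rfl⟩, hbx⟩ := not_bddAbove_iff.1 h b
  filter_upwards [eventually_ge_atTop x] with t ht
  exact hbx.le.trans (hη hx (le_trans (show (0 : ℝ) ≤ x from hx) ht) ht)

theorem eventually_mul_add_one_lt {m : ℕ → ℝ} (hm_pos : ∀ N, 0 < m N)
    (hm_top : Tendsto m atTop atTop) (hm_small : m =o[atTop] (fun N : ℕ => (N : ℝ))) (R : ℝ) :
    ∀ᶠ N : ℕ in atTop, R * m N + 1 < N := by
  -- With this constant, eventually `N ≥ (|R| + 2) m N ≥ R m N + 2 m N`, and `2 m N > 1` once `m N ≥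
  -- 1`.
  have hc : 0 < |R| + 2 := by positivity
  filter_upwards [hm_small.bound (inv_pos.2 hc), hm_top.eventually_ge_atTop 1] with N h1 h2
  rw [Real.norm_of_nonneg (hm_pos N).le, Real.norm_of_nonneg N.cast_nonneg, inv_mul_eq_div,
    le_div_iff₀ hc] at h1
  nlinarith [le_abs_self R, mul_le_mul_of_nonneg_right (le_abs_self R) (hm_pos N).le]

/-! ### Extraction of the subsequence and identification of its limits -/

/-- The compactness statement for a fixed realization of the paths. -/
theorem exists_subseq_limit {M : ℕ → ℝ} (hM : ∀ k, 0 < M k) (hM' : Tendsto M atTop atTop)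
    {n : ℕ → ℕ} (hn : ∀ R, ∀ᶠ k in atTop, R * M k + 1 < n k)
    {η : ℝ → ℝ} (hη_cont : ContinuousOn η (Ici 0)) (hη_mono : MonotoneOn η (Ici 0))
    (hη_pos : ∀ x, 0 ≤ x → 0 < η x) (hη_unbdd : ¬ BddAbove (η '' Ici 0)) (o : FactorOrder)
    {Y₁ Y₂ : (k : ℕ) → Fin (n k + 1) → ℝ} {w : ℕ → ℝ} {v : (k : ℕ) → Fin (n k) → ℝ} {y₁ y₂ : ℝ → ℝ}
    (hy₁ : ContinuousOn y₁ (Ici 0)) (hy₂ : ContinuousOn y₂ (Ici 0))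
    (hY₁ : CompactUniform (fun k => stepFn (M k) (Y₁ k)) y₁)
    (hY₂ : CompactUniform (fun k => stepFn (M k) (Y₂ k)) y₂) {C : ℝ}
    (hHC : ∀ k, vecNorm (M k) (reducedH o (M k) (Y₁ k) (Y₂ k) (w k) (v k)) ≤ C)
    (hvC : ∀ k, starNorm η (M k) (v k) ≤ C) :
    ∃ F ∈ maxDomain (y₁ + y₂), ∃ ψ : ℕ → ℕ, StrictMono ψ ∧
      CompactUniform (fun k => stepFn (M (ψ k)) (v (ψ k))) F ∧
      StrongL2 (fun k => stepFn (M (ψ k)) (v (ψ k))) F ∧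
      CompactUniform (fun k => stepFn (M (ψ k)) (diffQ (M (ψ k)) (v (ψ k)))) (halfDeriv F) ∧
      WeakL2 (fun k => stepFn (M (ψ k)) (diffQ (M (ψ k)) (v (ψ k)))) (halfDeriv F) ∧
      WeakL2 (fun k => stepFn (M (ψ k))
        (reducedH o (M (ψ k)) (Y₁ (ψ k)) (Y₂ (ψ k)) (w (ψ k)) (v (ψ k))))
        (contH (y₁ + y₂) F) := by
  have hC : 0 ≤ C := (vecNorm_nonneg _ _).trans (hHC 0)
  have hDC k : vecNorm (M k) (diffQ (M k) (v k)) ≤ C :=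
    (vecNorm_diffQ_le_starNorm η _ _).trans (hvC k)
  set ρ : ℝ → ℝ := fun x => √(1 + η x) with hρ
  have hρc : ContinuousOn ρ (Ici 0) := (continuousOn_const.add hη_cont).sqrt
  have hρ1 : ∀ x, 0 ≤ x → 1 ≤ ρ x := fun x hx =>
    Real.one_le_sqrt.2 (le_add_of_nonneg_right (hη_pos x hx).le)
  have hρm : MonotoneOn ρ (Ici 0) := fun a ha b hb hab =>
    Real.sqrt_le_sqrt (add_le_add_right (hη_mono ha hb hab) 1)
  have hρt : Tendsto ρ atTop atTop := Real.tendsto_sqrt_atTop.comp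
    (tendsto_atTop_add_const_left _ _ (tendsto_atTop_of_monotoneOn_Ici hη_mono hη_unbdd))
  have hw k := integral_weighted_sq_le η hC (hvC k)
  have hρL k := memLp_mul_stepFn hρc (hM k) (v k)
  have hv2 k : ∫ x, stepFn (M k) (v k) x ^ 2 ∂halfLine ≤ C ^ 2 := by
    refine (integral_mono_ae (memLp_stepFn _ _).integrable_sq (hρL k).integrable_sq ?_).trans (hw k)
    filter_upwards [ae_halfLine_nonneg] with x hx
    rw [mul_pow]
    exact le_mul_of_one_le_left (sq_nonneg _) (one_le_pow₀ (hρ1 x hx))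
  obtain ⟨G, ψ₁, hψ₁, hG⟩ := exists_subseq_weakL2 (fun k => memLp_stepFn (M k) (diffQ (M k) (v k)))
    hC fun k => integral_stepFn_sq_le (hM k) (hDC k)
  obtain ⟨H, ψ₂, hψ₂, hH⟩ := exists_subseq_weakL2
    (fun k => memLp_stepFn (M (ψ₁ k))
      (reducedH o (M (ψ₁ k)) (Y₁ (ψ₁ k)) (Y₂ (ψ₁ k)) (w (ψ₁ k)) (v (ψ₁ k))))
    hC fun k => integral_stepFn_sq_le (hM _) (hHC _)
  obtain ⟨c, -, ψ₃, hψ₃, hc⟩ := tendsto_subseq_of_bounded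
    (Metric.isBounded_closedBall (x := (0 : ℝ)) (r := 2 * C))
    (x := fun k => zeroExt (v (ψ₁ (ψ₂ k))) 0) fun k => by
      rw [mem_closedBall_zero_iff]
      exact abs_zeroExt_zero_le (hM _) hC (hv2 _) (hDC _)
  have hψ : StrictMono fun k => ψ₁ (ψ₂ (ψ₃ k)) := hψ₁.comp (hψ₂.comp hψ₃)
  replace hG := (hG.subseq hψ₂).subseq hψ₃
  replace hH := hH.subseq hψ₃
  have hsub {u : ℕ → ℝ → ℝ} {g : ℝ → ℝ} (h : CompactUniform u g) :
      CompactUniform (fun k => u (ψ₁ (ψ₂ (ψ₃ k)))) g := fun R s hs =>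
    hψ.tendsto_atTop.eventually (h R s hs)
  have hMψ : Tendsto (fun k => M (ψ₁ (ψ₂ (ψ₃ k)))) atTop atTop := hM'.comp hψ.tendsto_atTop
  have hFc : ContinuousOn (fun x => c + ∫ t in (0 : ℝ)..x, G t) (Ici 0) :=
    continuousOn_const.add (continuousOn_primitive_halfLine fun R hR =>
      intervalIntegrable_of_memLp hG.1 le_rfl hR)
  have hF := compactUniform_of_weak_diffQ (fun k => hM _) hMψ hC (fun k => hDC _) hG hc
  obtain ⟨d, hD⟩ := compactUniform_diffQ o (fun k => hM _) hMψ
    (fun R => hψ.tendsto_atTop.eventually (hn R)) hy₁ hy₂ (hsub hY₁) (hsub hY₂) hC (fun k => hDC _)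
    (fun k => hHC _) hFc hF hG hH
  have hy : ContinuousOn (y₁ + y₂) (Ici 0) := hy₁.add hy₂
  have hDc := (hy.mul hFc).add ((continuousOn_const (c := d)).add
    (continuousOn_primitive_halfLine fun R hR =>
      (intervalIntegrable_of_memLp hH.1 le_rfl hR).neg.sub
        (intervalIntegrable_continuousOn_mul hy hG.1 hR)))
  -- The weak limit `G` and the locally uniform limit of `D v` have equal primitives, both being the
  -- limit of the integrals of `D v` over `[0,x]`.
  obtain ⟨hFD, hGD, hF1, hF2, hHF⟩ := limit_regularity hy hG.1 hH.1 (fun _ _ => rfl)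
    (fun _ _ => rfl) hDc fun x hx => tendsto_nhds_unique (hG.tendsto_integral hx)
      (hD.tendsto_integral hx (fun k => intervalIntegrable_of_memLp (memLp_stepFn _ _) le_rfl hx)
        hDc)
  have hS := strongL2_of_weight (fun k => (memLp_stepFn _ _).aestronglyMeasurable) hρc hρ1 hρm hρt
    hC (fun k => eLpNorm_two_le (hρL _) hC (hw _)) hFc hF
  refine ⟨_, ⟨hF1, hS.1, hF2, (memLp_congr_ae hHF).1 hH.1⟩, _, hψ, hF, hS,
    hD.congr (fun _ _ _ => rfl) fun x hx => (hFD x hx).symm,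
    hG.congr (fun _ => EventuallyEq.rfl) ?_, hH.congr (fun _ => EventuallyEq.rfl) hHF⟩
  filter_upwards [ae_halfLine_nonneg, hGD] with x hx h
  rw [h, hFD x hx]

end SpikedTridiagonal

theorem mainTheorem8
    {Ω : Type*} [MeasurableSpace Ω] (P : Measure Ω) [IsProbabilityMeasure P]
    -- the mesh
    (m : ℕ → ℝ) (hm_pos : ∀ N, 0 < m N) (hm_top : Tendsto m atTop atTop)
    (hm_small : m =o[atTop] (fun N : ℕ => (N : ℝ)))
    -- the weight
    (η : ℝ → ℝ) (hη_cont : ContinuousOn η (Ici 0)) (hη_mono : MonotoneOn η (Ici 0))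
    (hη_pos : ∀ x, 0 ≤ x → 0 < η x) (hη_unbdd : ¬ BddAbove (η '' Ici 0))
    -- the random data of the ensemble and the limit paths
    (o : SpikedTridiagonal.FactorOrder)
    (Y₁ Y₂ : Ω → (N : ℕ) → Fin (N + 1) → ℝ) (w : Ω → ℕ → ℝ) (y₁ y₂ : Ω → ℝ → ℝ)
    (hY_zero : ∀ᵐ ω ∂P, ∀ N, Y₁ ω N 0 = 0 ∧ Y₂ ω N 0 = 0)
    (hy_cont : ∀ᵐ ω ∂P, ContinuousOn (y₁ ω) (Ici 0) ∧ ContinuousOn (y₂ ω) (Ici 0))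
    -- the subsequence of dimensions along which the paths converge almost surely
    (φ : ℕ → ℕ) (hφ : StrictMono φ)
    (hY_conv : ∀ᵐ ω ∂P,
      SpikedTridiagonal.CompactUniform
        (fun k => SpikedTridiagonal.stepFn (m (φ k)) (Y₁ ω (φ k))) (y₁ ω) ∧
      SpikedTridiagonal.CompactUniform
        (fun k => SpikedTridiagonal.stepFn (m (φ k)) (Y₂ ω (φ k))) (y₂ ω)) :
    ∀ᵐ ω ∂P, ∀ f : (N : ℕ) → Fin N → ℝ,
      (∃ C : ℝ, ∀ k,
        SpikedTridiagonal.vecNorm (m (φ k))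
          (SpikedTridiagonal.reducedH o (m (φ k)) (Y₁ ω (φ k)) (Y₂ ω (φ k)) (w ω (φ k))
            (f (φ k))) ≤ C ∧
        SpikedTridiagonal.starNorm η (m (φ k)) (f (φ k)) ≤ C) →
      ∃ F ∈ SpikedTridiagonal.maxDomain (y₁ ω + y₂ ω), ∃ ψ : ℕ → ℕ, StrictMono ψ ∧
        SpikedTridiagonal.CompactUniform
          (fun k => SpikedTridiagonal.stepFn (m (φ (ψ k))) (f (φ (ψ k)))) F ∧
        SpikedTridiagonal.StrongL2
          (fun k => SpikedTridiagonal.stepFn (m (φ (ψ k))) (f (φ (ψ k)))) F ∧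
        SpikedTridiagonal.CompactUniform
          (fun k => SpikedTridiagonal.stepFn (m (φ (ψ k)))
            (SpikedTridiagonal.diffQ (m (φ (ψ k))) (f (φ (ψ k)))))
          (SpikedTridiagonal.halfDeriv F) ∧
        SpikedTridiagonal.WeakL2
          (fun k => SpikedTridiagonal.stepFn (m (φ (ψ k)))
            (SpikedTridiagonal.diffQ (m (φ (ψ k))) (f (φ (ψ k)))))
          (SpikedTridiagonal.halfDeriv F) ∧
        SpikedTridiagonal.WeakL2
          (fun k => SpikedTridiagonal.stepFn (m (φ (ψ k)))
            (SpikedTridiagonal.reducedH o (m (φ (ψ k))) (Y₁ ω (φ (ψ k))) (Y₂ ω (φ (ψ k)))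
              (w ω (φ (ψ k))) (f (φ (ψ k)))))
          (SpikedTridiagonal.contH (y₁ ω + y₂ ω) F) := by
  -- The exceptional null set is fixed by the paths before `f` is chosen; the rest is deterministic.
  filter_upwards [hy_cont, hY_conv] with ω hyc hYc f hf
  obtain ⟨C, hC⟩ := hf
  exact SpikedTridiagonal.exists_subseq_limit (fun k => hm_pos _)
    (hm_top.comp hφ.tendsto_atTop)
    (fun R => hφ.tendsto_atTop.eventually
      (SpikedTridiagonal.eventually_mul_add_one_lt hm_pos hm_top hm_small R))
    hη_cont hη_mono hη_pos hη_unbdd o hyc.1 hyc.2 hYc.1 hYc.2 (fun k => (hC k).1)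
    fun k => (hC k).2
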